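/- Theorem 1.3. Let $V$ be a real vector space of finite dimension $m\ge 3$. A *generalized algebraic curvature operator* on $V$ is an element $\mathcal A\in V^*\otimes V^*\otimes\operatorname{End}(V)$ such that for all $x,y,z\in V$ $$\mathcal A(x,y)z=-\mathcal A(y,x)z,\qquad \mathcal A(x,y)z+\mathcal A(y,z)x+\mathcal A(z,x)y=0 .$$ Its Ricci tensor is $\rho(\mathcal A)(x,y)=\operatorname{Trace}\{z\mapsto\mathcal A(z,x)y\}$, with symmetric and antisymmetric parts $\rho_s(\mathcal A)$ and $\rho_a(\mathcal A)$. With respect to a non-degenerate symmetric bilinear form $\beta$ on $V$ and a basis $(e_i)$ of $V$, the scalar curvature is $\tau(\mathcal A,\beta)=\sum_{i,j}\beta^{ij}\rho(\mathcal A)(e_i,e_j)$, where $(\beta^{ij})$ is the inverse of the matrix $(\beta(e_i,e_j))$, and the trace-free Ricci tensor is $\rho_0(\mathcal A,\beta)=\rho_s(\mathcal A)-\frac{\tau(\mathcal A,\beta)}{m}\beta$. Let $g$ be a pseudo-Riemannian metric on the manifold $V$ which is of class $C^s$ for some integer $s\ge 1$ (resp. real analytic), and let $\mathcal A$ be a generalized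 algebraic curvature operator on $V$. Then there are an open neighborhood $U$ of $0$ in $V$ and a torsion-free connection $\nabla$ of class $C^s$ (resp. real analytic) on the tangent bundle of $U$, with curvature operator $\mathcal R^\nabla(X,Y)Z=\nabla_X\nabla_YZ-\nabla_Y\nabla_XZ-\nabla_{[X,Y]}Z$, such that, identifying $T_xV=V$: 1. $\mathcal R^\nabla_0=\mathcal A$. 2. $\nabla$ has constant scalar curvature with respect to $g$: the function $x\mapsto\tau(\mathcal R^\nabla_x,g_x)$ is constant on $U$. 3. If $\mathcal A$ is Ricci symmetric, i.e. $\rho_a(\mathcal A)=0$, then so is $\nabla$: $\rho_a(\mathcal R^\nabla_x)=0$ for all $x\in U$. 4. If $\mathcal A$ is Ricci antisymmetric, i.e. $\rho_s(\mathcal A)=0$, then so is $\nabla$: $\rho_s(\mathcal R^\nabla_x)=0$ for all $x\in U$. 5. If $\mathcal A$ is Ricci traceless, then so is $\nabla$, in both senses of the word: if $\rho_0(\mathcal A,g_0)=0$, then $\rho_0(\mathcal R^\nabla_x,g_x)=0$ for all $x\in U$; and if $\tau(\mathcal A,g_0)=0$, then $\tau(\mathcal R^\nabla_x,g_x)=0$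 for all $x\in U$. -/

import Mathlib

open scoped ContDiff Manifold

/-- `A x y z` stands for `𝒜(x, y) z`: an element of `V* ⊗ V* ⊗ End(V)` is a generalized algebraic
curvature operator if it is antisymmetric in its first two arguments and satisfies the first
Bianchi identity. -/
structure IsGeneralizedCurvatureOperator {V : Type*} [AddCommGroup V] [Module ℝ V]
    (A : V →ₗ[ℝ] V →ₗ[ℝ] Module.End ℝ V) : Prop where
  antisymm : ∀ x y z, A x y z = -A y x z
  bianchi : ∀ x y z, A x y z + A y z x + A z x y = 0

/-- The Ricci tensor `ρ(A)(x, y) = Trace (z ↦ A(z, x) y)`. -/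
noncomputable def ricci {V : Type*} [AddCommGroup V] [Module ℝ V]
    (A : V →ₗ[ℝ] V →ₗ[ℝ] Module.End ℝ V) : LinearMap.BilinForm ℝ V :=
  LinearMap.mk₂ ℝ
    (fun x y => LinearMap.trace ℝ V ((LinearMap.applyₗ y : Module.End ℝ V →ₗ[ℝ] V) ∘ₗ A.flip x))
    (fun x x' y => by rw [← map_add, map_add A.flip, LinearMap.comp_add])
    (fun c x y => by rw [map_smul A.flip, LinearMap.comp_smul, map_smul])
    (fun x y y' => by rw [← map_add, map_add LinearMap.applyₗ, LinearMap.add_comp])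
    (fun c x y => by rw [map_smul LinearMap.applyₗ, LinearMap.smul_comp, map_smul])

/-- The symmetric Ricci tensor `ρ_s`. -/
noncomputable def ricciSymm {V : Type*} [AddCommGroup V] [Module ℝ V]
    (A : V →ₗ[ℝ] V →ₗ[ℝ] Module.End ℝ V) (x y : V) : ℝ :=
  (ricci A x y + ricci A y x) / 2

/-- The antisymmetric Ricci tensor `ρ_a`. -/
noncomputable def ricciAntisymm {V : Type*} [AddCommGroup V] [Module ℝ V]
    (A : V →ₗ[ℝ] V →ₗ[ℝ] Module.End ℝ V) (x y : V) : ℝ :=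
  (ricci A x y - ricci A y x) / 2

/-- The scalar curvature `τ(A, β) = β^{ij} A_{kij}^k = β^{ij} ρ(A)(e_i, e_j)` with respect to a
non-degenerate symmetric bilinear form `β`, where `β^{ij}` is the inverse of the matrix
`β(e_i, e_j)`.  It is computed in a chosen basis; `scalarCurvature_eq_of_basis` shows that any other
basis gives the same number. -/
noncomputable def scalarCurvature {V : Type*} [AddCommGroup V] [Module ℝ V] [FiniteDimensional ℝ V]
    (A : V →ₗ[ℝ] V →ₗ[ℝ] Module.End ℝ V) (β : LinearMap.BilinForm ℝ V) : ℝ :=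
  ∑ i, ∑ j,
    (Matrix.of fun k l => β (Module.finBasis ℝ V k) (Module.finBasis ℝ V l))⁻¹ i j *
      ricci A (Module.finBasis ℝ V i) (Module.finBasis ℝ V j)

theorem sum_inv_mul_eq_trace {V : Type*} [AddCommGroup V] [Module ℝ V] {ι : Type*} [Fintype ι]
    [DecidableEq ι] (e : Module.Basis ι ℝ V) (ρ β : LinearMap.BilinForm ℝ V)
    (hβ : ∀ u v, β u v = β v u) :
    ∑ i, ∑ j, (Matrix.of fun k l => β (e k) (e l))⁻¹ i j * ρ (e i) (e j) =
      ((LinearMap.BilinForm.toMatrix e β)⁻¹ * LinearMap.BilinForm.toMatrix e ρ).trace := by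
  have h : (Matrix.of fun k l => β (e k) (e l)) = LinearMap.BilinForm.toMatrix e β := by
    ext k l
    simp
  have hs : (LinearMap.BilinForm.toMatrix e β)⁻¹.transpose =
      (LinearMap.BilinForm.toMatrix e β)⁻¹ := by
    rw [Matrix.transpose_nonsing_inv]
    congr 1
    ext k l
    simp [hβ (e k)]
  rw [h, Matrix.trace, Finset.sum_comm]
  refine Finset.sum_congr rfl fun j _ => ?_
  rw [Matrix.diag_apply, Matrix.mul_apply]
  refine Finset.sum_congr rfl fun i _ => ?_
  rw [← congrFun (congrFun hs j) i, Matrix.transpose_apply, LinearMap.BilinForm.toMatrix_apply]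

theorem scalarCurvature_eq_of_basis {V : Type*} [AddCommGroup V] [Module ℝ V]
    [FiniteDimensional ℝ V] {ι : Type*} [Fintype ι] [DecidableEq ι] (e : Module.Basis ι ℝ V)
    (A : V →ₗ[ℝ] V →ₗ[ℝ] Module.End ℝ V) (β : LinearMap.BilinForm ℝ V)
    (hβ : ∀ u v, β u v = β v u) :
    scalarCurvature A β =
      ∑ i, ∑ j, (Matrix.of fun k l => β (e k) (e l))⁻¹ i j * ricci A (e i) (e j) := by
  classical
  set b := Module.finBasis ℝ V
  let f : ι ≃ Fin (Module.finrank ℝ V) := e.indexEquiv b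
  let b' : Module.Basis ι ℝ V := b.reindex f.symm
  have h1 : scalarCurvature A β =
      ∑ i, ∑ j, (Matrix.of fun k l => β (b' k) (b' l))⁻¹ i j * ricci A (b' i) (b' j) := by
    have hM : (Matrix.of fun k l => β (b' k) (b' l)) =
        (Matrix.of fun k l => β (b k) (b l)).submatrix f f := by
      ext k l
      simp [b']
    rw [hM, Matrix.inv_submatrix_equiv]
    unfold scalarCurvature
    rw [← f.sum_comp]
    refine Finset.sum_congr rfl fun i _ => ?_
    rw [← f.sum_comp]
    simp [b', b]
  rw [h1, sum_inv_mul_eq_trace b' _ _ hβ, sum_inv_mul_eq_trace e _ _ hβ,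
    ← LinearMap.BilinForm.toMatrix_mul_basis_toMatrix e b' β,
    ← LinearMap.BilinForm.toMatrix_mul_basis_toMatrix e b' (ricci A)]
  set P := e.toMatrix b'
  have hP : IsUnit P.det := by
    have := e.toMatrix_mul_toMatrix_flip b'
    exact (Matrix.isUnit_iff_isUnit_det _).1 (IsUnit.of_mul_eq_one _ this)
  have hPt : IsUnit P.transpose.det := by rwa [Matrix.det_transpose]
  rw [Matrix.mul_inv_rev, Matrix.mul_inv_rev, Matrix.trace_mul_comm, Matrix.mul_assoc,
    Matrix.mul_assoc]
  rw [Matrix.mul_nonsing_inv_cancel_left _ _ hP, Matrix.trace_mul_comm, Matrix.mul_assoc,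
    Matrix.mul_assoc, Matrix.nonsing_inv_mul _ hPt, Matrix.mul_one, Matrix.trace_mul_comm]

/-- The trace-free Ricci tensor `ρ₀(A, β) = ρ_s(A) - (τ(A, β) / m) β`, where `m = dim V`. -/
noncomputable def ricciTraceFree {V : Type*} [AddCommGroup V] [Module ℝ V] [FiniteDimensional ℝ V]
    (A : V →ₗ[ℝ] V →ₗ[ℝ] Module.End ℝ V) (β : LinearMap.BilinForm ℝ V) (x y : V) : ℝ :=
  ricciSymm A x y - scalarCurvature A β / Module.finrank ℝ V * β x y

/-- `A` is Ricci symmetric: `ρ_a(A) = 0`. -/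
def IsRicciSymmetric {V : Type*} [AddCommGroup V] [Module ℝ V]
    (A : V →ₗ[ℝ] V →ₗ[ℝ] Module.End ℝ V) : Prop :=
  ∀ x y, ricciAntisymm A x y = 0

/-- `A` is Ricci antisymmetric: `ρ_s(A) = 0`. -/
def IsRicciAntisymmetric {V : Type*} [AddCommGroup V] [Module ℝ V]
    (A : V →ₗ[ℝ] V →ₗ[ℝ] Module.End ℝ V) : Prop :=
  ∀ x y, ricciSymm A x y = 0

/-- The trace-free Ricci tensor of `A` with respect to `β` vanishes: `ρ₀(A, β) = 0`. -/
def IsRicciTraceFreeVanishing {V : Type*} [AddCommGroup V] [Module ℝ V] [FiniteDimensional ℝ V]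
    (A : V →ₗ[ℝ] V →ₗ[ℝ] Module.End ℝ V) (β : LinearMap.BilinForm ℝ V) : Prop :=
  ∀ x y, ricciTraceFree A β x y = 0

/-- The Ricci tensor of `A` has trace zero with respect to `β`: `τ(A, β) = 0`. -/
def IsRicciTraceZero {V : Type*} [AddCommGroup V] [Module ℝ V] [FiniteDimensional ℝ V]
    (A : V →ₗ[ℝ] V →ₗ[ℝ] Module.End ℝ V) (β : LinearMap.BilinForm ℝ V) : Prop :=
  scalarCurvature A β = 0

/-- A pseudo-Riemannian metric of class `C^n` on the vector space `V`, regarded as a manifold with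
`T_x V = V`. -/
structure PseudoRiemannianMetric (V : Type*) [NormedAddCommGroup V] [NormedSpace ℝ V]
    (n : ℕ∞ω) where
  toFun : V → V →L[ℝ] V →L[ℝ] ℝ
  symm : ∀ x u v, toFun x u v = toFun x v u
  nondegenerate : ∀ x u, (∀ v, toFun x u v = 0) → u = 0
  contDiff : ContDiff ℝ n toFun

/-- The bilinear form `g_x` on `T_x V = V`. -/
noncomputable def PseudoRiemannianMetric.form {V : Type*} [NormedAddCommGroup V] [NormedSpace ℝ V] {n : ℕ∞ω}
    (g : PseudoRiemannianMetric V n) (x : V) : LinearMap.BilinForm ℝ V :=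
  LinearMap.mk₂ ℝ (fun u v => g.toFun x u v)
    (fun u u' v => by simp) (fun c u v => by simp) (fun u v v' => by simp) (fun c u v => by simp)

/-- A connection of class `C^n` on the tangent bundle of an open subset `U` of `V`: a covariant
derivative on `U`, such that `∇ Z` is of class `C^n` on `U` whenever the vector field `Z` is of class
`C^(n+1)` on `U`.  The vector `(∇_X Z)(x)` is `D.cov Z x (X x)`; vector fields are total functions,
but their values off `U` play no role. -/
structure AffineConnection {V : Type*} [NormedAddCommGroup V] [NormedSpace ℝ V]
    (U : TopologicalSpace.Opens V) (n : ℕ∞ω) where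
  cov : (V → V) → V → V →L[ℝ] V
  isCovariantDerivativeOn :
    IsCovariantDerivativeOn (I := 𝓘(ℝ, V)) V (V := fun x : V => TangentSpace 𝓘(ℝ, V) x) cov U
  contMDiffOn :
    ContMDiffCovariantDerivativeOn (I := 𝓘(ℝ, V)) V (V := fun x : V => TangentSpace 𝓘(ℝ, V) x)
      n cov U

namespace AffineConnection

/-- `∇` is torsion free: `∇_X Y - ∇_Y X = [X, Y]`. -/
def IsTorsionFree {V : Type*} [NormedAddCommGroup V] [NormedSpace ℝ V]
    {U : TopologicalSpace.Opens V} {n : ℕ∞ω} (D : AffineConnection U n) : Prop :=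
  ∀ X Y : V → V, ∀ x ∈ U, DifferentiableAt ℝ X x → DifferentiableAt ℝ Y x →
    D.cov Y x (X x) - D.cov X x (Y x) = VectorField.lieBracket ℝ X Y x

/-- The vector `(∇_X ∇_Y Z - ∇_Y ∇_X Z - ∇_{[X, Y]} Z)(x)`. -/
noncomputable def curvatureField {V : Type*} [NormedAddCommGroup V] [NormedSpace ℝ V]
    {U : TopologicalSpace.Opens V} {n : ℕ∞ω} (D : AffineConnection U n) (X Y Z : V → V) (x : V) :
    V :=
  D.cov (fun y => D.cov Z y (Y y)) x (X x) - D.cov (fun y => D.cov Z y (X y)) x (Y x) -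
    D.cov Z x (VectorField.lieBracket ℝ X Y x)

theorem mdifferentiableAt_section {V : Type*} [NormedAddCommGroup V] [NormedSpace ℝ V] {Z : V → V}
    {x : V} (hZ : DifferentiableAt ℝ Z x) :
    MDifferentiableAt 𝓘(ℝ, V) (𝓘(ℝ, V).prod 𝓘(ℝ, V))
      (fun y => (⟨y, Z y⟩ : TangentBundle 𝓘(ℝ, V) V)) x := by
  rw [mdifferentiableAt_totalSpace]
  refine ⟨mdifferentiableAt_id, ?_⟩
  simpa [mdifferentiableAt_iff_differentiableAt] using hZ

theorem cov_add {V : Type*} [NormedAddCommGroup V] [NormedSpace ℝ V]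
    {U : TopologicalSpace.Opens V} {n : ℕ∞ω} (D : AffineConnection U n) {Z Z' : V → V} {x : V}
    (hx : x ∈ U) (hZ : DifferentiableAt ℝ Z x) (hZ' : DifferentiableAt ℝ Z' x) :
    D.cov (fun y => Z y + Z' y) x = D.cov Z x + D.cov Z' x :=
  D.isCovariantDerivativeOn.add (mdifferentiableAt_section hZ) (mdifferentiableAt_section hZ') hx

theorem cov_smul {V : Type*} [NormedAddCommGroup V] [NormedSpace ℝ V]
    {U : TopologicalSpace.Opens V} {n : ℕ∞ω} (D : AffineConnection U n) {Z : V → V} {x : V} (c : ℝ)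
    (hx : x ∈ U) (hZ : DifferentiableAt ℝ Z x) :
    D.cov (fun y => c • Z y) x = c • D.cov Z x :=
  D.isCovariantDerivativeOn.smul_const c (mdifferentiableAt_section hZ) hx

theorem cov_congr {V : Type*} [NormedAddCommGroup V] [NormedSpace ℝ V]
    {U : TopologicalSpace.Opens V} {n : ℕ∞ω} (D : AffineConnection U n) {Z Z' : V → V} {x : V}
    (hx : x ∈ U) (hZ : DifferentiableAt ℝ Z x) (hZ' : DifferentiableAt ℝ Z' x)
    (h : ∀ y ∈ U, Z y = Z' y) : D.cov Z x = D.cov Z' x :=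
  D.isCovariantDerivativeOn.congr_of_eqOn (mdifferentiableAt_section hZ)
    (mdifferentiableAt_section hZ') (U.isOpen.mem_nhds hx) h

theorem differentiableAt_cov_const {V : Type*} [NormedAddCommGroup V] [NormedSpace ℝ V]
    {U : TopologicalSpace.Opens V} {n : ℕ∞ω} (D : AffineConnection U n) (hn : 1 ≤ n) {x : V}
    (hx : x ∈ U) (v w : V) : DifferentiableAt ℝ (fun y => D.cov (fun _ => w) y v) x := by
  have h1 := D.contMDiffOn.contMDiff (σ := fun _ => w)
    (contMDiffOn_vectorSpace_iff_contDiffOn.2 contDiffOn_const) x hx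
  rw [contMDiffWithinAt_hom_bundle] at h1
  simp only [inCoordinates_tangent_bundle_core_model_space] at h1
  have h2 : ContDiffAt ℝ n (D.cov fun _ => w) x :=
    (contMDiffWithinAt_iff_contDiffWithinAt.1 h1.2).contDiffAt (U.isOpen.mem_nhds hx)
  exact (h2.differentiableAt (zero_lt_one.trans_le hn).ne').clm_apply (differentiableAt_const v)

theorem curvatureField_const {V : Type*} [NormedAddCommGroup V] [NormedSpace ℝ V]
    {U : TopologicalSpace.Opens V} {n : ℕ∞ω} (D : AffineConnection U n) (u v w x : V) :
    D.curvatureField (fun _ => u) (fun _ => v) (fun _ => w) x =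
      D.cov (fun y => D.cov (fun _ => w) y v) x u - D.cov (fun y => D.cov (fun _ => w) y u) x v := by
  simp [curvatureField, VectorField.lieBracket]

/-- The curvature operator `R_x(u, v) w = (∇_u ∇_v w - ∇_v ∇_u w - ∇_{[u, v]} w)(x)` of a connection
that is at least `C^1`, where the tangent vectors `u`, `v`, `w` at `x` are extended to constant
vector fields. -/
noncomputable def curvature {V : Type*} [NormedAddCommGroup V] [NormedSpace ℝ V]
    {U : TopologicalSpace.Opens V} {n : ℕ∞ω} (D : AffineConnection U n) (hn : 1 ≤ n) (x : U) :
    V →ₗ[ℝ] V →ₗ[ℝ] Module.End ℝ V :=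
  LinearMap.mk₂ ℝ
    (fun u v =>
      { toFun := fun w => D.curvatureField (fun _ => u) (fun _ => v) (fun _ => w) x
        map_add' := by
          intro w w'
          have key : ∀ a, D.cov (fun y => D.cov (fun _ => w + w') y a) x =
              D.cov (fun y => D.cov (fun _ => w) y a) x +
                D.cov (fun y => D.cov (fun _ => w') y a) x := fun a => by
            have h := D.differentiableAt_cov_const hn x.2 a
            rw [← D.cov_add x.2 (h w) (h w')]
            refine D.cov_congr x.2 (h _) ((h w).add (h w')) fun y hy => ?_
            rw [D.cov_add hy (differentiableAt_const w) (differentiableAt_const w')]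
            rfl
          simp only [curvatureField_const, key, add_apply]
          abel
        map_smul' := by
          intro c w
          have key : ∀ a, D.cov (fun y => D.cov (fun _ => c • w) y a) x =
              c • D.cov (fun y => D.cov (fun _ => w) y a) x := fun a => by
            have h := D.differentiableAt_cov_const hn x.2 a
            rw [← D.cov_smul c x.2 (h w)]
            refine D.cov_congr x.2 (h _) ((h w).const_smul c) fun y hy => ?_
            rw [D.cov_smul c hy (differentiableAt_const w)]
            rfl
          simp only [curvatureField_const, key, smul_apply, smul_sub,
            RingHom.id_apply] })
    (by
      intro u u' v
      ext w
      have h := fun a => D.differentiableAt_cov_const hn x.2 a w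
      simp only [LinearMap.coe_mk, AddHom.coe_mk, LinearMap.add_apply, curvatureField_const,
        map_add, D.cov_add x.2 (h u) (h u'), add_apply]
      abel)
    (by
      intro c u v
      ext w
      have h := fun a => D.differentiableAt_cov_const hn x.2 a w
      simp only [LinearMap.coe_mk, AddHom.coe_mk, LinearMap.smul_apply, curvatureField_const,
        map_smul, D.cov_smul c x.2 (h u), smul_apply, smul_sub])
    (by
      intro u v v'
      ext w
      have h := fun a => D.differentiableAt_cov_const hn x.2 a w
      simp only [LinearMap.coe_mk, AddHom.coe_mk, LinearMap.add_apply, curvatureField_const,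
        map_add, D.cov_add x.2 (h v) (h v'), add_apply]
      abel)
    (by
      intro c u v
      ext w
      have h := fun a => D.differentiableAt_cov_const hn x.2 a w
      simp only [LinearMap.coe_mk, AddHom.coe_mk, LinearMap.smul_apply, curvatureField_const,
        map_smul, D.cov_smul c x.2 (h v), smul_apply, smul_sub])

end AffineConnection

/-! Look for `∇ = D + Γ` with `Γ_x = L_x + T(f(x))`. The linear part `L_u(v, w) = (A(u, v)w + A(u,
w)v) / 3` is symmetric in `v, w`, and by the Bianchi identity its curvature at `0` is `A`
(`linearChristoffel_sub`). The correction `T(f)` has one unknown function `f_s` for each unordered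
pair `s = {j, k}`, placed in the single slot `Γ_{jk}^{d(s)}` with `d(s) ∉ s`. Such an index exists
because `m ≥ 3`.

The contraction of `T(f)` over its upper index and a lower one vanishes, so `f` enters the Ricci
tensor only through the divergence, which is `∂_{d(s)} f_s`, and through terms quadratic in `Γ`,
which are symmetric. Thus `ρ_a` stays equal to `ρ_a(A)`, while prescribing `ρ_s = S_x` becomes the
Goursat system `∂_{d(s)} f_s = F_s(x, f)` with `f_s = 0` on `x_{d(s)} = 0`
(`ricci_curvature_christoffel`). If `S_0 = ρ_s(A)`, then `F(0, 0) = 0`, so `f` and `Df` vanish at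
`0` and the curvature there is still `A`.

The Goursat problem is solved in class `C^n`, analytic case included, by the implicit function
theorem in a Banach space of continuous functions on a cube (`Goursat.exists_solution`). The choice
`S_x = τ/m g_x +` (the `g_x`-trace-free part of `ρ_0(A, g_0)`), with `τ = τ(A, g_0)`, has constant
trace and vanishes, or is a multiple of `g_x`, when the same holds at `0`
(`PseudoRiemannianMetric.extend`). All five claims follow. -/

/-! ### Regularity of postcomposition on `C(K, X)` -/

section Postcomposition

universe u

variable {K : Type*} [TopologicalSpace K] [CompactSpace K]
  {X Y : Type u} [NormedAddCommGroup X] [NormedSpace ℝ X] [NormedAddCommGroup Y] [NormedSpace ℝ Y]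

/-- Pointwise application `(a, h) ↦ (t ↦ a t (h t))` as a continuous bilinear map. -/
noncomputable def ContinuousMap.pointwiseApply (K : Type*) [TopologicalSpace K] [CompactSpace K]
    (X Y : Type u) [NormedAddCommGroup X] [NormedSpace ℝ X] [NormedAddCommGroup Y]
    [NormedSpace ℝ Y] : C(K, X →L[ℝ] Y) →L[ℝ] C(K, X) →L[ℝ] C(K, Y) :=
  LinearMap.mkContinuous₂ (E := C(K, X →L[ℝ] Y)) (F := C(K, X)) (G := C(K, Y))
    (LinearMap.mk₂ ℝ (fun (a : C(K, X →L[ℝ] Y)) (h : C(K, X)) =>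
        (⟨fun t => a t (h t), a.continuous.clm_apply h.continuous⟩ : C(K, Y)))
      (fun a a' h => by ext; simp) (fun c a h => by ext; simp)
      (fun a h h' => by ext; simp) (fun c a h => by ext; simp)) 1
    (fun a h => by
      rw [ContinuousMap.norm_le _ (by positivity)]
      intro t
      rw [one_mul]
      exact (ContinuousLinearMap.le_opNorm _ _).trans
        (mul_le_mul (a.norm_coe_le_norm t) (h.norm_coe_le_norm t) (norm_nonneg _) (norm_nonneg a)))

theorem ContinuousMap.hasFDerivAt_comp_left {F : C(X, Y)} {F' : C(X, X →L[ℝ] Y)}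
    (hF : ∀ x, HasFDerivAt F (F' x) x) (w : C(K, X)) :
    HasFDerivAt (fun v : C(K, X) => F.comp v)
      (ContinuousMap.pointwiseApply K X Y (F'.comp w)) w := by
  rw [hasFDerivAt_iff_isLittleO_nhds_zero, Asymptotics.isLittleO_iff]
  intro ε hε
  have hc : Continuous fun v : C(K, X) => F'.comp v := ContinuousMap.continuous_postcomp F'
  obtain ⟨δ, hδ, hδ'⟩ := (Metric.continuous_iff (α := C(K, X)) (β := C(K, X →L[ℝ] Y))).1 hc w ε hε
  filter_upwards [Metric.ball_mem_nhds (0 : C(K, X)) hδ] with h hh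
  rw [mem_ball_zero_iff] at hh
  rw [ContinuousMap.norm_le _ (by positivity)]
  intro t
  -- `δ` must not depend on `t`. Continuity of `v ↦ F' ∘ v` at `w`, tested on perturbations of `w`
  -- by constants, gives this uniformity.
  have key : ∀ z ∈ Metric.ball (w t) δ, ‖F' z - F' (w t)‖ ≤ ε := by
    intro z hz
    have h1 := hδ' (w + ContinuousMap.const K (z - w t)) (by
      rw [dist_eq_norm, add_sub_cancel_left, ContinuousMap.norm_lt_iff _ hδ]
      intro s
      simpa [dist_eq_norm] using hz)
    have h2 := (ContinuousMap.dist_apply_le_dist (f := F'.comp (w + ContinuousMap.const K (z - w t)))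
      (g := F'.comp w) t).trans h1.le
    simpa [dist_eq_norm] using h2
  have hb : ‖h t‖ < δ := (h.norm_coe_le_norm t).trans_lt hh
  have h3 := (convex_ball (w t) δ).norm_image_sub_le_of_norm_hasFDerivWithin_le'
    (f := F) (φ := F' (w t)) (C := ε) (x := w t) (y := w t + h t)
    (fun z _ => (hF z).hasFDerivWithinAt) key (Metric.mem_ball_self hδ)
    (by simpa [dist_eq_norm] using hb)
  rw [add_sub_cancel_left] at h3
  exact h3.trans (mul_le_mul_of_nonneg_left (h.norm_coe_le_norm t) hε.le)

/-- The derivative at `w` is pointwise application of `F' ∘ w`, so the induction passes from `F` to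
`F'`. The target changes to `X →L[ℝ] Y`, hence the common universe. -/
theorem ContDiff.contDiff_continuousMap_comp_nat (s : ℕ) {X Y : Type u} [NormedAddCommGroup X]
    [NormedSpace ℝ X] [NormedAddCommGroup Y] [NormedSpace ℝ Y] (F : C(X, Y))
    (hF : ContDiff ℝ s F) : ContDiff ℝ s (fun v : C(K, X) => F.comp v) := by
  induction s generalizing Y with
  | zero =>
    exact contDiff_zero.2 (ContinuousMap.continuous_postcomp F)
  | succ s ih =>
    have h1 : ContDiff ℝ (s + 1 : ℕ∞ω) F := by exact_mod_cast hF
    obtain ⟨hd, -, hF'⟩ := contDiff_succ_iff_fderiv.1 h1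
    let F' : C(X, X →L[ℝ] Y) := ⟨fderiv ℝ F, hF'.continuous⟩
    have hder := ContinuousMap.hasFDerivAt_comp_left (K := K) (F := F) (F' := F')
      (fun x => (hd x).hasFDerivAt)
    have : ContDiff ℝ (s + 1 : ℕ∞ω) (fun v : C(K, X) => F.comp v) := by
      rw [contDiff_succ_iff_fderiv]
      refine ⟨fun w => (hder w).differentiableAt, by simp, ?_⟩
      rw [funext fun w => (hder w).fderiv]
      exact (ContinuousMap.pointwiseApply K X Y).contDiff.comp (ih F' hF')
    exact_mod_cast this

/-- The formal multilinear series on `C(K, X)` acting pointwise by a given one on `X`. -/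
noncomputable def FormalMultilinearSeries.pointwise (K : Type*) [TopologicalSpace K]
    [CompactSpace K] (p : FormalMultilinearSeries ℝ X Y) :
    FormalMultilinearSeries ℝ C(K, X) C(K, Y) := fun n =>
  MultilinearMap.mkContinuous
    { toFun := fun m => ⟨fun t => p n fun i => m i t,
        (p n).cont.comp (continuous_pi fun i => (m i).continuous)⟩
      map_update_add' := by
        intro _ m i x y
        ext t
        have : ∀ z : C(K, X), (fun j => Function.update m i z j t) =
            Function.update (fun j => m j t) i (z t) := fun z => by
          ext j
          by_cases h : j = i
          · subst h; simp
          · simp [h]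
        simp [this]
      map_update_smul' := by
        intro _ m i c x
        ext t
        have : ∀ z : C(K, X), (fun j => Function.update m i z j t) =
            Function.update (fun j => m j t) i (z t) := fun z => by
          ext j
          by_cases h : j = i
          · subst h; simp
          · simp [h]
        simp [this] } ‖p n‖ (fun m => by
      rw [ContinuousMap.norm_le _ (by positivity)]
      intro t
      exact ((p n).le_opNorm _).trans (mul_le_mul_of_nonneg_left
        (Finset.prod_le_prod (fun _ _ => norm_nonneg _) fun i _ => (m i).norm_coe_le_norm t)
        (norm_nonneg _)))

theorem FormalMultilinearSeries.norm_pointwise_le (p : FormalMultilinearSeries ℝ X Y) (n : ℕ) :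
    ‖p.pointwise K n‖ ≤ ‖p n‖ :=
  MultilinearMap.mkContinuous_norm_le _ (norm_nonneg _) _

/-- The power series of `F` at `0`, applied pointwise, has coefficients of no larger norm, so it
converges on at least the same ball. The centre is `0`: at a nonconstant function the expansion
point would vary with `t`. -/
theorem AnalyticAt.analyticAt_continuousMap_comp [CompleteSpace Y] {F : C(X, Y)}
    (hF : AnalyticAt ℝ F 0) : AnalyticAt ℝ (fun v : C(K, X) => F.comp v) 0 := by
  obtain ⟨p, r, hp⟩ := hF
  have hr : r ≤ (p.pointwise K).radius := by
    refine hp.r_le.trans (FormalMultilinearSeries.radius_le_of_le ?_)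
    exact p.norm_pointwise_le
  refine ⟨p.pointwise K, r, hr, hp.r_pos, ?_⟩
  intro y hy
  have h1 := (p.pointwise K).hasSum (x := y) (Metric.eball_subset_eball hr hy)
  have h2 : (p.pointwise K).sum y = F.comp (0 + y) := by
    ext t
    have h3 := h1.mapL (ContinuousMap.evalCLM ℝ t)
    have hyt : y t ∈ Metric.eball (0 : X) r := by
      rw [Metric.mem_eball, edist_zero_right] at hy ⊢
      refine lt_of_le_of_lt ?_ hy
      rw [enorm_le_iff_norm_le]
      exact y.norm_coe_le_norm t
    exact h3.unique (hp.hasSum hyt)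
  rwa [← h2]

/-- Composition with a `C^n` map on the left is `C^n` at `0` on spaces of continuous maps. -/
theorem ContDiff.contDiffAt_continuousMap_comp [CompleteSpace Y] {n : ℕ∞ω}
    (hn : (∃ s : ℕ, n = s) ∨ n = ω) {F : C(X, Y)} (hF : ContDiff ℝ n F) :
    ContDiffAt ℝ n (fun v : C(K, X) => F.comp v) 0 := by
  rcases hn with ⟨s, rfl⟩ | rfl
  · exact (ContDiff.contDiff_continuousMap_comp_nat s F hF).contDiffAt
  · exact (AnalyticAt.analyticAt_continuousMap_comp hF.contDiffAt.analyticAt).contDiffAt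

end Postcomposition

/-! ### The Goursat problem via the implicit function theorem -/

namespace Goursat

universe u

variable {ι N : Type u} [Fintype ι]

/-- `x ↦ (t ↦ t * x)`, with `t` in the unit cube. -/
noncomputable def scale (ι : Type u) [Fintype ι] :
    (ι → ℝ) →L[ℝ] C(ι → unitInterval, ι → ℝ) :=
  LinearMap.toContinuousLinearMap
    { toFun := fun x => ⟨fun t i => t i * x i, by fun_prop⟩
      map_add' := fun x y => by ext; simp [mul_add]
      map_smul' := fun c x => by ext; simp; ring }

theorem scale_apply (x : ι → ℝ) (t : ι → unitInterval) (i : ι) :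
    scale ι x t i = t i * x i := rfl

/-- `x ↦ (t ↦ (t * x) ∘ d)`, with `t` in the unit cube. -/
noncomputable def coordinate (d : N → ι) :
    (ι → ℝ) →L[ℝ] C(ι → unitInterval, N → ℝ) :=
  LinearMap.toContinuousLinearMap
    { toFun := fun x => ⟨fun t c => t (d c) * x (d c), by fun_prop⟩
      map_add' := fun x y => by ext; simp [mul_add]
      map_smul' := fun c x => by ext; simp; ring }

theorem coordinate_apply (d : N → ι) (x : ι → ℝ) (t : ι → unitInterval) (c : N) :
    coordinate d x t c = t (d c) * x (d c) := rfl

/-- `(x, u) ↦ (t ↦ (t * x, u t))`. -/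
noncomputable def graph (ι N : Type u) [Fintype ι] [Fintype N] :
    (ι → ℝ) × C(ι → unitInterval, N → ℝ) →L[ℝ] C(ι → unitInterval, (ι → ℝ) × (N → ℝ)) :=
  ((ContinuousLinearMap.compLeftContinuous ℝ (ι → unitInterval)
    (ContinuousLinearMap.inl ℝ (ι → ℝ) (N → ℝ))).comp (scale ι)).coprod
    (ContinuousLinearMap.compLeftContinuous ℝ (ι → unitInterval)
      (ContinuousLinearMap.inr ℝ (ι → ℝ) (N → ℝ)))

theorem graph_apply [Fintype N] (z : (ι → ℝ) × C(ι → unitInterval, N → ℝ)) (t : ι → unitInterval) :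
    graph ι N z t = (scale ι z.1 t, z.2 t) := by
  simp [graph]

theorem continuous_shrink {ι : Type*} [DecidableEq ι] (i : ι) :
    Continuous fun p : (ι → unitInterval) × unitInterval =>
    Function.update p.1 i (p.1 i * p.2) :=
  continuous_fst.update i (((continuous_apply i).comp continuous_fst).mul continuous_snd)

variable [DecidableEq ι] [Fintype N]

/-- The average of the `c`-th component over the segment in direction `d c` which ends at the
given point of the unit cube and starts at the face `t (d c) = 0`. -/
noncomputable def average (d : N → ι) :
    C(ι → unitInterval, N → ℝ) →L[ℝ] C(ι → unitInterval, N → ℝ) :=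
  have hcont : ∀ (v : C(ι → unitInterval, N → ℝ)) (c : N),
      Continuous fun p : (ι → unitInterval) × unitInterval =>
        v (Function.update p.1 (d c) (p.1 (d c) * p.2)) c := fun v c =>
    (continuous_apply c).comp (v.continuous.comp (continuous_shrink (d c)))
  have hint : ∀ (v : C(ι → unitInterval, N → ℝ)) (c : N) (t : ι → unitInterval),
      MeasureTheory.Integrable (fun s : unitInterval =>
        v (Function.update t (d c) (t (d c) * s)) c) := fun v c t =>
    ((hcont v c).comp (Continuous.prodMk_right t)).integrable_of_hasCompactSupport
      (HasCompactSupport.of_compactSpace _)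
  LinearMap.mkContinuous (E := C(ι → unitInterval, N → ℝ)) (F := C(ι → unitInterval, N → ℝ))
    { toFun := fun v =>
        ⟨fun t c => ∫ s : unitInterval, v (Function.update t (d c) (t (d c) * s)) c, by
          refine continuous_pi fun c => ?_
          simpa using continuous_parametric_integral_of_continuous
            (μ := (MeasureTheory.volume : MeasureTheory.Measure unitInterval))
            (f := fun t s => v (Function.update t (d c) (t (d c) * s)) c) (hcont v c)
            isCompact_univ⟩
      map_add' := fun v w => by
        ext t c
        exact MeasureTheory.integral_add (hint v c t) (hint w c t)
      map_smul' := fun a v => by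
        ext t c
        exact MeasureTheory.integral_const_mul a _ } 1
    (fun v => by
      rw [ContinuousMap.norm_le _ (by positivity)]
      intro t
      rw [pi_norm_le_iff_of_nonneg (by positivity)]
      intro c
      have := MeasureTheory.norm_integral_le_of_norm_le_const
        (μ := (MeasureTheory.volume : MeasureTheory.Measure unitInterval))
        (f := fun s => v (Function.update t (d c) (t (d c) * s)) c) (C := ‖v‖)
        (Filter.Eventually.of_forall fun s => (norm_le_pi_norm _ c).trans (v.norm_coe_le_norm _))
      simpa using this)

/-- Averaging over the rescaled segment, instead of integrating up to `x (d c)`, makes the operator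
linear and independent of `x`; the length of the segment is the separate factor `coordinate`. -/
theorem average_apply (d : N → ι) (v : C(ι → unitInterval, N → ℝ)) (t : ι → unitInterval) (c : N) :
    average d v t c = ∫ s : unitInterval, v (Function.update t (d c) (t (d c) * s)) c := rfl

/-- The defect of `t ↦ u t` as a solution, rescaled to the unit cube, of the integral equation
`f x c = ∫ r in 0..x (d c), F (p r, f (p r)) c`, `p r = Function.update x (d c) r`. -/
noncomputable def defect (d : N → ι) (F : C((ι → ℝ) × (N → ℝ), N → ℝ))
    (z : (ι → ℝ) × C(ι → unitInterval, N → ℝ)) : C(ι → unitInterval, N → ℝ) :=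
  z.2 - coordinate d z.1 * average d (F.comp (graph ι N z))

theorem defect_apply (d : N → ι) (F : C((ι → ℝ) × (N → ℝ), N → ℝ)) (x : ι → ℝ)
    (v : C(ι → unitInterval, N → ℝ)) (t : ι → unitInterval) (c : N) :
    defect d F (x, v) t c = v t c - t (d c) * x (d c) *
      ∫ s : unitInterval, F (scale ι x (Function.update t (d c) (t (d c) * s)),
        v (Function.update t (d c) (t (d c) * s))) c := by
  simp [defect, average_apply, coordinate_apply, graph_apply]

/-- If `v` solves the equation on the box spanned by `x`, its restriction to the sub-box spanned by
`t * x`, rescaled to the cube, solves the equation there. With uniqueness, this makes the solutions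
for different `x` fit together. -/
theorem defect_rescale (d : N → ι) (F : C((ι → ℝ) × (N → ℝ), N → ℝ)) (x : ι → ℝ)
    (v : C(ι → unitInterval, N → ℝ)) (t : ι → unitInterval) :
    defect d F (scale ι x t, v.comp ⟨fun s => t * s, by fun_prop⟩) =
      (defect d F (x, v)).comp ⟨fun s => t * s, by fun_prop⟩ := by
  ext s c
  have hup : ∀ r : unitInterval, t * Function.update s (d c) (s (d c) * r) =
      Function.update (t * s) (d c) ((t * s) (d c) * r) := by
    intro r
    ext i
    by_cases h : i = d c
    · subst h; simp [mul_assoc]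
    · simp [h]
  have hsc : ∀ q : ι → unitInterval, scale ι (scale ι x t) q = scale ι x (t * q) := by
    intro q
    ext i
    simp [scale_apply]
    ring
  simp only [defect_apply, ContinuousMap.comp_apply, ContinuousMap.coe_mk, hsc, hup, scale_apply]
  simp only [Pi.mul_apply, Set.Icc.coe_mul]
  ring

theorem contDiffAt_defect {n : ℕ∞ω} (hn : (∃ s : ℕ, n = s) ∨ n = ω) (d : N → ι)
    (F : C((ι → ℝ) × (N → ℝ), N → ℝ)) (hF : ContDiff ℝ n F) :
    ContDiffAt ℝ n (defect d F) 0 := by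
  have h1 : ContDiffAt ℝ n (fun z => F.comp (graph ι N z)) 0 := by
    have := ContDiff.contDiffAt_continuousMap_comp (K := ι → unitInterval) hn hF
    rw [← map_zero (graph ι N)] at this
    exact this.comp (0 : (ι → ℝ) × C(ι → unitInterval, N → ℝ)) (graph ι N).contDiff.contDiffAt
  exact contDiffAt_snd.sub (((coordinate d).contDiff.contDiffAt.comp _ contDiffAt_fst).mul
    ((average d).contDiff.contDiffAt.comp _ h1))

/-- At `x = 0` the box is a point and the integral term vanishes, so `defect d F (0, v) = v`. -/
theorem fderiv_defect_comp_inr {n : ℕ∞ω} (hn : 1 ≤ n) (d : N → ι)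
    (F : C((ι → ℝ) × (N → ℝ), N → ℝ)) (h : ContDiffAt ℝ n (defect d F) 0) :
    fderiv ℝ (defect d F) 0 ∘L .inr ℝ _ _ = .id ℝ _ := by
  have h1 := (h.differentiableAt (zero_lt_one.trans_le hn).ne').hasFDerivAt
  have h2 : HasFDerivAt (fun v : C(ι → unitInterval, N → ℝ) => defect d F (0, v))
      (fderiv ℝ (defect d F) 0 ∘L .inr ℝ _ _) 0 :=
    HasFDerivAt.comp (g := defect d F) (0 : C(ι → unitInterval, N → ℝ)) h1
      (ContinuousLinearMap.inr ℝ (ι → ℝ) C(ι → unitInterval, N → ℝ)).hasFDerivAt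
  have h3 : (fun v : C(ι → unitInterval, N → ℝ) => defect d F (0, v)) = id := by
    ext v t c
    simp [defect]
  rw [h3] at h2
  exact h2.unique (hasFDerivAt_id _)

/-- Near `0`, the integral equation has a `C^n` solution. -/
theorem exists_integral_solution {n : ℕ∞ω} (hn1 : 1 ≤ n)
    (hn : (∃ s : ℕ, n = s) ∨ n = ω) (d : N → ι)
    (F : C((ι → ℝ) × (N → ℝ), N → ℝ)) (hF : ContDiff ℝ n F) :
    ∃ f : (ι → ℝ) → N → ℝ, ∃ r > 0, (∀ x ∈ Metric.ball 0 r, ContDiffAt ℝ n f x) ∧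
      ∀ x ∈ Metric.ball 0 r, ∀ c, f x c = x (d c) * ∫ s : unitInterval,
        F (Function.update x (d c) (s * x (d c)), f (Function.update x (d c) (s * x (d c)))) c := by
  have hΦ := contDiffAt_defect hn d F hF
  have hn0 : n ≠ 0 := (zero_lt_one.trans_le hn1).ne'
  have hinv : (fderiv ℝ (defect d F) 0 ∘L .inr ℝ _ _).IsInvertible := by
    rw [fderiv_defect_comp_inr hn1 d F hΦ]
    exact ⟨.refl ℝ _, rfl⟩
  set u := hΦ.implicitFunction hn0 hinv with hu
  have hu0 : u 0 = 0 := hΦ.implicitFunction_apply_self hn0 hinv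
  have hΦ0 : defect d F 0 = 0 := by
    ext
    simp [defect]
  have h1 := hΦ.eventually_apply_implicitFunction hn0 hinv
  have h2 := hΦ.eventually_apply_eq_iff_implicitFunction hn0 hinv
  have h3 : ContDiffAt ℝ n u 0 := hΦ.contDiffAt_implicitFunction hn0 hinv
  rw [← hu] at h1 h2
  rw [hΦ0] at h1 h2
  -- Here `n = ∞` must be excluded: `C^∞` at a point does not provide one neighbourhood that serves
  -- all finite orders.
  have h4 := h3.eventually (by rcases hn with ⟨s, rfl⟩ | rfl <;> simp)
  obtain ⟨r₁, hr₁, h2⟩ := Metric.eventually_nhds_iff_ball.1 h2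
  have h5 : ∀ᶠ x in nhds 0, u x ∈ Metric.ball 0 r₁ := by
    have := h3.continuousAt
    rw [ContinuousAt, hu0] at this
    exact this (Metric.ball_mem_nhds _ hr₁)
  obtain ⟨r, hr, h6⟩ := Metric.eventually_nhds_iff_ball.1
    (((h1.and h4).and h5).and (Metric.ball_mem_nhds (0 : ι → ℝ) hr₁))
  have hscale : ∀ x t, ‖scale ι x t‖ ≤ ‖x‖ := by
    intro x t
    rw [pi_norm_le_iff_of_nonneg (norm_nonneg _)]
    intro i
    rw [scale_apply, norm_mul]
    refine (mul_le_of_le_one_left (norm_nonneg _) ?_).trans (norm_le_pi_norm x i)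
    rw [Real.norm_of_nonneg (t i).2.1]
    exact (t i).2.2
  -- The rescaled `u x` solves the equation for the parameter `t * x` and, since rescaling increases
  -- neither norm, stays in the ball where the solution is unique. Hence `f x = u x 1` satisfies `f
  -- (t * x) = u x t`, and the regularity of `f` is that of `u` in its parameter.
  have key : ∀ x ∈ Metric.ball 0 r, ∀ t, u (scale ι x t) 1 = u x t := by
    intro x hx t
    obtain ⟨⟨⟨hx1, -⟩, hx2⟩, hx3⟩ := h6 x hx
    have hcomp : ‖(u x).comp (⟨fun s => t * s, by fun_prop⟩ : C(ι → unitInterval, _))‖ ≤ ‖u x‖ := by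
      rw [ContinuousMap.norm_le _ (norm_nonneg _)]
      exact fun s => (u x).norm_coe_le_norm _
    have h7 := (h2 (scale ι x t, (u x).comp ⟨fun s => t * s, by fun_prop⟩) (by
      rw [mem_ball_zero_iff] at hx2 ⊢
      rw [dist_zero_right] at hx3
      exact max_lt ((hscale x t).trans_lt hx3) (hcomp.trans_lt hx2))).1 (by
        rw [defect_rescale, hx1]
        rfl)
    rw [h7]
    simp
  refine ⟨fun x => u x 1, r, hr, fun x hx => ?_, fun x hx c => ?_⟩
  · exact (ContinuousMap.evalCLM ℝ (1 : ι → unitInterval)).contDiff.contDiffAt.comp x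
      (h6 x hx).1.1.2
  · have h8 := congrFun (DFunLike.congr_fun (h6 x hx).1.1.1 1) c
    rw [defect_apply] at h8
    have hsc : ∀ s : unitInterval, scale ι x (Function.update 1 (d c) s) =
        Function.update x (d c) (s * x (d c)) := by
      intro s
      ext i
      by_cases h : i = d c
      · subst h; simp [scale_apply]
      · simp [scale_apply, h]
    simp only [Pi.one_apply, Set.Icc.coe_one, one_mul] at h8
    simp only [← hsc, key x hx]
    exact sub_eq_zero.1 (h8.trans rfl)

/-- The Goursat problem `∂_{d c} f_c = F(x, f)_c`, with `f_c = 0` on the hyperplane `x_{d c} = 0`,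
has a `C^n` solution near `0`. -/
theorem exists_solution {n : ℕ∞ω} (hn1 : 1 ≤ n)
    (hn : (∃ s : ℕ, n = s) ∨ n = ω) (d : N → ι)
    (F : (ι → ℝ) × (N → ℝ) → N → ℝ) (hF : ContDiff ℝ n F) :
    ∃ f : (ι → ℝ) → N → ℝ, ∃ r > 0, (∀ x ∈ Metric.ball 0 r, ContDiffAt ℝ n f x) ∧
      (∀ x ∈ Metric.ball 0 r, ∀ c, x (d c) = 0 → f x c = 0) ∧
      ∀ x ∈ Metric.ball 0 r, ∀ c, fderiv ℝ f x (Pi.single (d c) 1) c = F (x, f x) c := by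
  obtain ⟨f, r, hr, hf, h⟩ := exists_integral_solution hn1 hn d ⟨F, hF.continuous⟩ hF
  refine ⟨f, r, hr, hf, fun x hx c hc => by rw [h x hx, hc, zero_mul], fun x hx c => ?_⟩
  have hmem : ∀ a : ℝ, |a| < r → Function.update x (d c) a ∈ Metric.ball 0 r := by
    intro a ha
    rw [mem_ball_zero_iff, pi_norm_lt_iff hr] at hx ⊢
    intro i
    by_cases hi : i = d c
    · subst hi; simpa using ha
    · simpa [hi] using hx i
  have hxc : |x (d c)| < r := by
    rw [mem_ball_zero_iff, pi_norm_lt_iff hr] at hx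
    exact hx _
  set φ : ℝ → ℝ := fun a => F (Function.update x (d c) a, f (Function.update x (d c) a)) c with hφ
  have hφc : ∀ a, |a| < r → ContinuousAt φ a := by
    intro a ha
    have h1 : ContinuousAt (Function.update x (d c)) a :=
      (continuous_const.update (d c) continuous_id).continuousAt
    have h2 : ContinuousAt f (Function.update x (d c) a) := (hf _ (hmem a ha)).continuousAt
    have h3 : ContinuousAt (fun a => f (Function.update x (d c) a)) a :=
      ContinuousAt.comp (f := Function.update x (d c)) h2 h1
    exact (continuous_apply c).continuousAt.comp
      (hF.continuous.continuousAt.comp (h1.prodMk h3))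
  -- Substitute `b = s * a`; the oriented integral covers both signs of `a`.
  have hint : ∀ a, |a| < r → f (Function.update x (d c) a) c = ∫ b in (0 : ℝ)..a, φ b := by
    intro a ha
    rw [h _ (hmem a ha) c]
    simp only [Function.update_self, Function.update_idem, ContinuousMap.coe_mk]
    rw [MeasureTheory.integral_subtype measurableSet_Icc (fun s : ℝ => φ (s * a)),
      MeasureTheory.integral_Icc_eq_integral_Ioc,
      ← intervalIntegral.integral_of_le zero_le_one, ← smul_eq_mul,
      intervalIntegral.smul_integral_comp_mul_right]
    simp
  have hIoo : ∀ a, |a| < r → Set.Ioo (-r) r ∈ nhds a := fun a ha =>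
    Ioo_mem_nhds (abs_lt.1 ha).1 (abs_lt.1 ha).2
  have hcont : ContinuousOn φ (Set.Ioo (-r) r) := fun a ha =>
    (hφc a (abs_lt.2 ha)).continuousWithinAt
  have hd1 : HasDerivAt (fun a => f (Function.update x (d c) a) c) (φ (x (d c))) (x (d c)) := by
    have := intervalIntegral.integral_hasDerivAt_right (f := φ) (a := 0) (b := x (d c))
      (ContinuousOn.intervalIntegrable fun a ha => (hφc a ?_).continuousWithinAt)
      (hcont.stronglyMeasurableAtFilter isOpen_Ioo _ (abs_lt.1 hxc)) (hφc _ hxc)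
    · refine this.congr_of_eventuallyEq ?_
      filter_upwards [hIoo _ hxc] with a ha
      exact hint a (abs_lt.2 ha)
    · refine lt_of_le_of_lt ?_ hxc
      simpa using Set.abs_sub_left_of_mem_uIcc ha
  have hd2 : HasDerivAt (fun a => f (Function.update x (d c) a) c)
      (fderiv ℝ f x (Pi.single (d c) 1) c) (x (d c)) := by
    have h1 := ((hf x hx).differentiableAt (zero_lt_one.trans_le hn1).ne').hasFDerivAt
    rw [← Function.update_eq_self (d c) x] at h1
    have h2 := h1.comp_hasDerivAt (x (d c)) (hasDerivAt_update x (d c) (x (d c)))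
    rw [Function.update_eq_self] at h2
    exact (hasDerivAt_pi.1 h2) c
  rw [hd2.unique hd1, hφ]
  simp only [Function.update_eq_self]

end Goursat

/-! ### Connections given by Christoffel symbols -/

namespace AffineConnection

variable {V : Type*} [NormedAddCommGroup V] [NormedSpace ℝ V] {U : TopologicalSpace.Opens V}
  {n : ℕ∞ω}

theorem differentiableAt_of_mdifferentiableAt_section {Z : V → V} {x : V}
    (hZ : MDifferentiableAt 𝓘(ℝ, V) (𝓘(ℝ, V).prod 𝓘(ℝ, V))
      (fun y => (⟨y, Z y⟩ : TangentBundle 𝓘(ℝ, V) V)) x) : DifferentiableAt ℝ Z x := by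
  rw [mdifferentiableAt_totalSpace] at hZ
  simpa [mdifferentiableAt_iff_differentiableAt] using hZ.2

theorem fderiv_add_christoffel (G : V →L[ℝ] V →L[ℝ] V) {Z Z' : V → V} {x : V}
    (hZ : DifferentiableAt ℝ Z x) (hZ' : DifferentiableAt ℝ Z' x) :
    fderiv ℝ (Z + Z') x + G.flip ((Z + Z') x) =
      (fderiv ℝ Z x + G.flip (Z x)) + (fderiv ℝ Z' x + G.flip (Z' x)) := by
  rw [fderiv_add hZ hZ', Pi.add_apply, map_add]
  abel

theorem fderiv_smul_christoffel (G : V →L[ℝ] V →L[ℝ] V) {φ : V → ℝ} {Z : V → V} {x : V}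
    (hφ : DifferentiableAt ℝ φ x) (hZ : DifferentiableAt ℝ Z x) :
    fderiv ℝ (φ • Z) x + G.flip ((φ • Z) x) =
      φ x • (fderiv ℝ Z x + G.flip (Z x)) + (fderiv ℝ φ x).smulRight (Z x) := by
  rw [fderiv_smul hφ hZ, Pi.smul_apply', map_smul, smul_add]
  abel

/-- The connection `∇_v Z = D_v Z + Γ(v, Z)` with Christoffel symbols `Γ`. -/
noncomputable def ofChristoffel (Γ : V → V →L[ℝ] V →L[ℝ] V) (hΓ : ContDiffOn ℝ n Γ U) :
    AffineConnection U n where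
  cov Z x := fderiv ℝ Z x + (Γ x).flip (Z x)
  isCovariantDerivativeOn :=
    { add := fun {σ σ' x} hσ hσ' _ =>
        fderiv_add_christoffel (Γ x) (differentiableAt_of_mdifferentiableAt_section hσ)
          (differentiableAt_of_mdifferentiableAt_section hσ')
      leibniz := fun {σ g x} hσ hg _ => by
        have h := fderiv_smul_christoffel (Γ x) (mdifferentiableAt_iff_differentiableAt.1 hg)
          (differentiableAt_of_mdifferentiableAt_section hσ)
        rw [← mfderiv_eq_fderiv (f := g)] at h
        exact h }
  contMDiffOn :=
    { contMDiff := fun {σ} hσ => by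
        have h : ContDiffOn ℝ (n + 1) σ U := contMDiffOn_vectorSpace_iff_contDiffOn.1 hσ
        have h1 : ContDiffOn ℝ n (fun x => fderiv ℝ σ x + (Γ x).flip (σ x)) U := by
          refine (h.fderiv_of_isOpen U.isOpen le_rfl).add ?_
          have h2 : ContDiffOn ℝ n (fun x => (Γ x).flip) U :=
            (ContinuousLinearMap.flipₗᵢ ℝ V V V).contDiff.comp_contDiffOn hΓ
          exact h2.clm_apply (h.of_le le_self_add)
        intro x hx
        rw [contMDiffWithinAt_hom_bundle]
        simp only [inCoordinates_tangent_bundle_core_model_space]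
        exact ⟨contMDiffWithinAt_id, contMDiffWithinAt_iff_contDiffWithinAt.2 (h1 x hx)⟩ }

theorem ofChristoffel_cov (Γ : V → V →L[ℝ] V →L[ℝ] V) (hΓ : ContDiffOn ℝ n Γ U) (Z : V → V)
    (x v : V) : (ofChristoffel Γ hΓ).cov Z x v = fderiv ℝ Z x v + Γ x v (Z x) := rfl

theorem isTorsionFree_ofChristoffel (Γ : V → V →L[ℝ] V →L[ℝ] V) (hΓ : ContDiffOn ℝ n Γ U)
    (hsymm : ∀ x ∈ U, ∀ v w, Γ x v w = Γ x w v) : (ofChristoffel Γ hΓ).IsTorsionFree := by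
  intro X Y x hx _ _
  rw [ofChristoffel_cov, ofChristoffel_cov, VectorField.lieBracket, hsymm x hx (X x)]
  abel

theorem curvature_ofChristoffel (hn : 1 ≤ n) (Γ : V → V →L[ℝ] V →L[ℝ] V)
    (hΓ : ContDiffOn ℝ n Γ U) (x : U) (u v w : V) :
    (ofChristoffel Γ hΓ).curvature hn x u v w =
      fderiv ℝ Γ x u v w - fderiv ℝ Γ x v u w + Γ x u (Γ x v w) - Γ x v (Γ x u w) := by
  have hd : DifferentiableAt ℝ Γ x := (hΓ.contDiffAt (U.isOpen.mem_nhds x.2)).differentiableAt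
    (zero_lt_one.trans_le hn).ne'
  have key : ∀ a, (fun y => (ofChristoffel Γ hΓ).cov (fun _ => w) y a) = fun y => Γ y a w := by
    intro a
    ext y
    simp [ofChristoffel_cov]
  have hder : ∀ a c, fderiv ℝ (fun y => Γ y a w) x c = fderiv ℝ Γ x c a w := by
    intro a c
    have h1 := (hd.hasFDerivAt.clm_apply (hasFDerivAt_const a (x : V))).clm_apply
      (hasFDerivAt_const w (x : V))
    rw [h1.fderiv]
    simp
  change (ofChristoffel Γ hΓ).curvatureField (fun _ => u) (fun _ => v) (fun _ => w) x = _
  rw [curvatureField_const, key, key, ofChristoffel_cov, ofChristoffel_cov, hder, hder]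
  abel

end AffineConnection

/-! ### Traces with respect to a metric and their dependence on the point -/

section MetricTrace

variable {V : Type*} [AddCommGroup V] [Module ℝ V] [FiniteDimensional ℝ V]

/-- The trace of `ρ` with respect to `β`. -/
noncomputable def metricTrace (β : LinearMap.BilinForm ℝ V) (ρ : V → V → ℝ) : ℝ :=
  ∑ i, ∑ j,
    (Matrix.of fun k l => β (Module.finBasis ℝ V k) (Module.finBasis ℝ V l))⁻¹ i j *
      ρ (Module.finBasis ℝ V i) (Module.finBasis ℝ V j)

theorem scalarCurvature_eq_metricTrace (A : V →ₗ[ℝ] V →ₗ[ℝ] Module.End ℝ V)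
    (β : LinearMap.BilinForm ℝ V) :
    scalarCurvature A β = metricTrace β (fun v w => ricci A v w) := rfl

theorem metricTrace_add (β : LinearMap.BilinForm ℝ V) (ρ ρ' : V → V → ℝ) :
    metricTrace β (fun v w => ρ v w + ρ' v w) = metricTrace β ρ + metricTrace β ρ' := by
  simp [metricTrace, mul_add, Finset.sum_add_distrib]

theorem metricTrace_mul (β : LinearMap.BilinForm ℝ V) (a : ℝ) (ρ : V → V → ℝ) :
    metricTrace β (fun v w => a * ρ v w) = a * metricTrace β ρ := by
  simp only [metricTrace, Finset.mul_sum]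
  exact Finset.sum_congr rfl fun i _ => Finset.sum_congr rfl fun j _ => by ring

theorem metricTrace_sub (β : LinearMap.BilinForm ℝ V) (ρ ρ' : V → V → ℝ) :
    metricTrace β (fun v w => ρ v w - ρ' v w) = metricTrace β ρ - metricTrace β ρ' := by
  simp [metricTrace, mul_sub, Finset.sum_sub_distrib]

theorem metricTrace_swap {β : LinearMap.BilinForm ℝ V} (hβ : ∀ u v, β u v = β v u)
    (ρ : V → V → ℝ) : metricTrace β (fun v w => ρ w v) = metricTrace β ρ := by
  set M := Matrix.of fun k l => β (Module.finBasis ℝ V k) (Module.finBasis ℝ V l) with hM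
  have h : M⁻¹.transpose = M⁻¹ := by
    rw [Matrix.transpose_nonsing_inv]
    congr 1
    ext k l
    exact hβ _ _
  have h' : ∀ i j, M⁻¹ i j = M⁻¹ j i := fun i j => congrFun (congrFun h j) i
  rw [metricTrace, metricTrace, Finset.sum_comm]
  refine Finset.sum_congr rfl fun i _ => Finset.sum_congr rfl fun j _ => ?_
  rw [← hM, h']

theorem det_gram_ne_zero {β : LinearMap.BilinForm ℝ V} (hβ : ∀ u, (∀ v, β u v = 0) → u = 0) :
    (Matrix.of fun k l => β (Module.finBasis ℝ V k) (Module.finBasis ℝ V l)).det ≠ 0 := by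
  have h := (LinearMap.BilinForm.SeparatingLeft.toMatrix (B := β) hβ (Module.finBasis ℝ V))
  have h2 : (Matrix.of fun k l => β (Module.finBasis ℝ V k) (Module.finBasis ℝ V l)) =
      LinearMap.BilinForm.toMatrix (Module.finBasis ℝ V) β := by
    ext k l
    simp
  rw [h2]
  exact Matrix.separatingLeft_iff_det_ne_zero.1 h

theorem metricTrace_self {β : LinearMap.BilinForm ℝ V} (hs : ∀ u v, β u v = β v u)
    (hβ : ∀ u, (∀ v, β u v = 0) → u = 0) :
    metricTrace β (fun v w => β v w) = Module.finrank ℝ V := by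
  have h := det_gram_ne_zero hβ
  rw [metricTrace, sum_inv_mul_eq_trace _ _ _ hs]
  have h2 : (Matrix.of fun k l => β (Module.finBasis ℝ V k) (Module.finBasis ℝ V l)) =
      LinearMap.BilinForm.toMatrix (Module.finBasis ℝ V) β := by
    ext k l
    simp
  rw [h2] at h
  rw [Matrix.nonsing_inv_mul _ h.isUnit, Matrix.trace_one, Fintype.card_fin]

end MetricTrace

theorem ContDiff.matrix_det {E m : Type*} [NormedAddCommGroup E] [NormedSpace ℝ E] [Fintype m]
    [DecidableEq m] {n : ℕ∞ω} {M : E → Matrix m m ℝ} (hM : ∀ i j, ContDiff ℝ n fun x => M x i j) :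
    ContDiff ℝ n fun x => (M x).det := by
  simp only [Matrix.det_apply, Units.smul_def, zsmul_eq_mul]
  exact ContDiff.sum fun σ _ => contDiff_const.mul (contDiff_prod fun i _ => hM _ _)

/-- Cramer's rule: each entry is a quotient of determinants, which are polynomials in the entries of
`M x`. -/
theorem ContDiff.matrix_inv {E m : Type*} [NormedAddCommGroup E] [NormedSpace ℝ E] [Fintype m]
    [DecidableEq m] {n : ℕ∞ω} {M : E → Matrix m m ℝ} (hM : ∀ i j, ContDiff ℝ n fun x => M x i j)
    (h0 : ∀ x, (M x).det ≠ 0) (i j : m) : ContDiff ℝ n fun x => (M x)⁻¹ i j := by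
  simp only [Matrix.inv_def, Ring.inverse_eq_inv', Matrix.smul_apply, smul_eq_mul,
    Matrix.adjugate_apply]
  refine ((ContDiff.matrix_det hM).inv h0).mul (ContDiff.matrix_det fun k l => ?_)
  by_cases h : k = j
  · subst h
    simpa using contDiff_const
  · simpa [Matrix.updateRow_ne h] using hM k l

/-! ### Extending the symmetric Ricci tensor with constant trace -/

namespace PseudoRiemannianMetric

variable {V : Type*} [NormedAddCommGroup V] [NormedSpace ℝ V] {n : ℕ∞ω}

theorem form_symm (g : PseudoRiemannianMetric V n) (x u v : V) : g.form x u v = g.form x v u :=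
  g.symm x u v

theorem form_nondegenerate (g : PseudoRiemannianMetric V n) (x u : V)
    (h : ∀ v, g.form x u v = 0) : u = 0 :=
  g.nondegenerate x u h

theorem contDiff_form (g : PseudoRiemannianMetric V n) (u v : V) :
    ContDiff ℝ n fun x => g.form x u v :=
  (g.contDiff.clm_apply contDiff_const).clm_apply contDiff_const

theorem contDiff_metricTrace [FiniteDimensional ℝ V] (g : PseudoRiemannianMetric V n)
    (ρ : V → V → ℝ) : ContDiff ℝ n fun x => metricTrace (g.form x) ρ :=
  ContDiff.sum fun i _ => ContDiff.sum fun j _ =>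
    (ContDiff.matrix_inv (fun _ _ => g.contDiff_form _ _)
      (fun x => det_gram_ne_zero (g.form_nondegenerate x)) i j).mul contDiff_const

/-- A family of symmetric bilinear forms with constant trace `metricTrace (g.form 0) ρ`, equal to
`ρ` at `0`. -/
noncomputable def extend [FiniteDimensional ℝ V] (g : PseudoRiemannianMetric V n)
    (ρ : LinearMap.BilinForm ℝ V) (x : V) : LinearMap.BilinForm ℝ V :=
  ρ + ((metricTrace (g.form 0) (fun v w => ρ v w) -
      metricTrace (g.form x) (fun v w => ρ v w - metricTrace (g.form 0) (fun v w => ρ v w) /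
        Module.finrank ℝ V * g.form 0 v w)) / Module.finrank ℝ V) • g.form x -
    (metricTrace (g.form 0) (fun v w => ρ v w) / Module.finrank ℝ V) • g.form 0

theorem extend_apply [FiniteDimensional ℝ V] (g : PseudoRiemannianMetric V n)
    (ρ : LinearMap.BilinForm ℝ V) (x v w : V) :
    g.extend ρ x v w = ρ v w + (metricTrace (g.form 0) (fun v w => ρ v w) -
      metricTrace (g.form x) (fun v w => ρ v w - metricTrace (g.form 0) (fun v w => ρ v w) /
        Module.finrank ℝ V * g.form 0 v w)) / Module.finrank ℝ V * g.form x v w -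
    metricTrace (g.form 0) (fun v w => ρ v w) / Module.finrank ℝ V * g.form 0 v w := by
  simp [extend]

theorem contDiff_extend [FiniteDimensional ℝ V] (g : PseudoRiemannianMetric V n)
    (ρ : LinearMap.BilinForm ℝ V) (v w : V) : ContDiff ℝ n fun x => g.extend ρ x v w := by
  simp only [extend_apply]
  exact (contDiff_const.add (((contDiff_const.sub (g.contDiff_metricTrace _)).div_const _).mul
    (g.contDiff_form v w))).sub contDiff_const

theorem extend_symm [FiniteDimensional ℝ V] (g : PseudoRiemannianMetric V n)
    {ρ : LinearMap.BilinForm ℝ V} (hρ : ∀ v w, ρ v w = ρ w v) (x v w : V) :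
    g.extend ρ x v w = g.extend ρ x w v := by
  rw [extend_apply, extend_apply, hρ, g.form_symm x v, g.form_symm 0 v]

/-- The trace-free part of `ρ` is zero, so there is no trace to remove at `x`, and only the
pure-trace part, carried along by `g_x`, remains. -/
theorem extend_eq_of_traceFree [FiniteDimensional ℝ V] (g : PseudoRiemannianMetric V n)
    {ρ : LinearMap.BilinForm ℝ V}
    (hρ : ∀ v w, ρ v w = metricTrace (g.form 0) (fun v w => ρ v w) /
      Module.finrank ℝ V * g.form 0 v w) (x v w : V) :
    g.extend ρ x v w = metricTrace (g.form 0) (fun v w => ρ v w) /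
      Module.finrank ℝ V * g.form x v w := by
  have h : metricTrace (g.form x) (fun v w => ρ v w - metricTrace (g.form 0) (fun v w => ρ v w) /
        Module.finrank ℝ V * g.form 0 v w) = 0 := by
    simp only [← hρ, sub_self]
    simp [metricTrace]
  rw [extend_apply, h, ← hρ, sub_zero]
  ring

variable [FiniteDimensional ℝ V] [Nontrivial V]

theorem extend_zero (g : PseudoRiemannianMetric V n) (ρ : LinearMap.BilinForm ℝ V) :
    g.extend ρ 0 = ρ := by
  have hm : (Module.finrank ℝ V : ℝ) ≠ 0 := by exact_mod_cast Module.finrank_pos.ne'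
  ext v w
  rw [extend_apply, metricTrace_sub, metricTrace_mul,
    metricTrace_self (g.form_symm 0) (g.form_nondegenerate 0)]
  field_simp
  ring

/-- With `τ` the trace of `ρ` at `0` and `ρ₀ = ρ - (τ/m) g_0`, the form is `(τ/m) g_x + (ρ₀ - (tr_x
ρ₀ / m) g_x)`. The bracket has `g_x`-trace zero because `g_x` has trace `m`. -/
theorem metricTrace_extend (g : PseudoRiemannianMetric V n) (ρ : LinearMap.BilinForm ℝ V)
    (x : V) : metricTrace (g.form x) (fun v w => g.extend ρ x v w) =
      metricTrace (g.form 0) (fun v w => ρ v w) := by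
  have hm : (Module.finrank ℝ V : ℝ) ≠ 0 := by exact_mod_cast Module.finrank_pos.ne'
  simp only [extend_apply]
  rw [metricTrace_sub, metricTrace_add, metricTrace_mul, metricTrace_mul,
    metricTrace_self (g.form_symm x) (g.form_nondegenerate x), metricTrace_sub, metricTrace_mul]
  field_simp
  ring

end PseudoRiemannianMetric

/-! ### Ricci tensor in a basis, and the linear Christoffel symbols -/

theorem ricci_eq_sum {V ι : Type*} [AddCommGroup V] [Module ℝ V] [Fintype ι]
    (b : Module.Basis ι ℝ V) (A : V →ₗ[ℝ] V →ₗ[ℝ] Module.End ℝ V) (v w : V) :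
    ricci A v w = ∑ i, b.repr (A (b i) v w) i := by
  classical
  change LinearMap.trace ℝ V _ = _
  rw [LinearMap.trace_eq_matrix_trace ℝ b, Matrix.trace]
  refine Finset.sum_congr rfl fun i _ => ?_
  rw [Matrix.diag_apply, LinearMap.toMatrix_apply]
  rfl

theorem ricci_eq_symm_add_antisymm {V : Type*} [AddCommGroup V] [Module ℝ V]
    (A : V →ₗ[ℝ] V →ₗ[ℝ] Module.End ℝ V) (v w : V) :
    ricci A v w = ricciSymm A v w + ricciAntisymm A v w := by
  rw [ricciSymm, ricciAntisymm]
  ring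

namespace IsGeneralizedCurvatureOperator

variable {V : Type*} [NormedAddCommGroup V] [NormedSpace ℝ V] [FiniteDimensional ℝ V]

/-- Christoffel symbols, depending linearly on the point, whose curvature at the origin is `A`. -/
noncomputable def linearChristoffel (A : V →ₗ[ℝ] V →ₗ[ℝ] Module.End ℝ V) :
    V →L[ℝ] V →L[ℝ] V →L[ℝ] V :=
  LinearMap.toContinuousLinearMap
    { toFun := fun x => LinearMap.toContinuousLinearMap
        { toFun := fun v => LinearMap.toContinuousLinearMap
            ((3⁻¹ : ℝ) • (A x v + (A x).flip v))
          map_add' := fun v v' => by ext; simp; module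
          map_smul' := fun c v => by ext; simp; module }
      map_add' := fun x x' => by ext; simp; module
      map_smul' := fun c x => by ext; simp; module }

theorem linearChristoffel_apply (A : V →ₗ[ℝ] V →ₗ[ℝ] Module.End ℝ V) (x v w : V) :
    linearChristoffel A x v w = (3⁻¹ : ℝ) • (A x v w + A x w v) := rfl

theorem linearChristoffel_symm (A : V →ₗ[ℝ] V →ₗ[ℝ] Module.End ℝ V) (x v w : V) :
    linearChristoffel A x v w = linearChristoffel A x w v := by
  rw [linearChristoffel_apply, linearChristoffel_apply, add_comm]

/-- Antisymmetry contributes `2 A(u, v)w`, and the Bianchi identity turns the remaining `A(u, w)v -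
A(v, w)u` into a third copy; this fixes the factor `1/3`. -/
theorem linearChristoffel_sub {A : V →ₗ[ℝ] V →ₗ[ℝ] Module.End ℝ V}
    (hA : IsGeneralizedCurvatureOperator A) (u v w : V) :
    linearChristoffel A u v w - linearChristoffel A v u w = A u v w := by
  rw [linearChristoffel_apply, linearChristoffel_apply]
  have h := hA.bianchi u v w
  rw [hA.antisymm w u v] at h
  rw [hA.antisymm v u w]
  have h' : A u w v = A u v w + A v w u := by
    rw [← sub_eq_zero, ← neg_eq_zero, ← h]
    abel
  rw [h']
  module

end IsGeneralizedCurvatureOperator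

/-! ### The off-diagonal correction and its equations -/

namespace ChristoffelAnsatz

variable {V ι : Type*} [NormedAddCommGroup V] [NormedSpace ℝ V] [Fintype ι]
  (b : Module.Basis ι ℝ V)

/-- The part of the Ricci tensor which is quadratic in the Christoffel symbols `G`. -/
noncomputable def quadraticRicci (G : V →L[ℝ] V →L[ℝ] V) : LinearMap.BilinForm ℝ V :=
  LinearMap.mk₂ ℝ
    (fun v w => ∑ i, b.repr (G (b i) (G v w)) i - ∑ i, b.repr (G v (G (b i) w)) i)
    (fun v v' w => by simp [Finset.sum_add_distrib]; ring)
    (fun c v w => by simp [Finset.mul_sum, mul_sub])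
    (fun v w w' => by simp [Finset.sum_add_distrib]; ring)
    (fun c v w => by simp [Finset.mul_sum, mul_sub])

theorem quadraticRicci_apply (G : V →L[ℝ] V →L[ℝ] V) (v w : V) : quadraticRicci b G v w =
    ∑ i, b.repr (G (b i) (G v w)) i - ∑ i, b.repr (G v (G (b i) w)) i := rfl

theorem quadraticRicci_zero : quadraticRicci b (0 : V →L[ℝ] V →L[ℝ] V) = 0 := by
  ext v w
  simp [quadraticRicci_apply]

theorem sum_repr_comp_comm (f g : V →ₗ[ℝ] V) :
    ∑ i, b.repr (f (g (b i))) i = ∑ i, b.repr (g (f (b i))) i := by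
  classical
  have h : ∀ f : V →ₗ[ℝ] V, LinearMap.trace ℝ V f = ∑ i, b.repr (f (b i)) i := fun f => by
    rw [LinearMap.trace_eq_matrix_trace ℝ b, Matrix.trace]
    simp [LinearMap.toMatrix_apply]
  have := LinearMap.trace_mul_comm ℝ f g
  rwa [h, h] at this

/-- The second sum is `tr (G_v ∘ G_w)`, symmetric by cyclicity of the trace. This is why the
correction leaves `ρ_a` alone. -/
theorem quadraticRicci_symm {G : V →L[ℝ] V →L[ℝ] V} (hG : ∀ v w, G v w = G w v) (v w : V) :
    quadraticRicci b G v w = quadraticRicci b G w v := by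
  rw [quadraticRicci_apply, quadraticRicci_apply, hG v w]
  congr 1
  simp only [hG (b _) _]
  exact sum_repr_comp_comm b (G v).toLinearMap (G w).toLinearMap

theorem bilinForm_eq_sum (B : LinearMap.BilinForm ℝ V) (v w : V) :
    B v w = ∑ j, ∑ k, B (b j) (b k) * b.repr v j * b.repr w k := by
  conv_lhs => rw [← b.sum_repr v, ← b.sum_repr w]
  simp only [map_sum, map_smul, LinearMap.sum_apply, LinearMap.smul_apply, smul_eq_mul,
    Finset.mul_sum]
  rw [Finset.sum_comm]
  exact Finset.sum_congr rfl fun j _ => Finset.sum_congr rfl fun k _ => by ring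

variable [FiniteDimensional ℝ V]

theorem contDiff_quadraticRicci {n : ℕ∞ω} (v w : V) :
    ContDiff ℝ n fun G : V →L[ℝ] V →L[ℝ] V => quadraticRicci b G v w := by
  have hrepr : ∀ i, ContDiff ℝ n fun u : V => b.repr u i := fun i =>
    (LinearMap.toContinuousLinearMap (b.coord i)).contDiff
  have happ : ∀ {f h : (V →L[ℝ] V →L[ℝ] V) → V}, ContDiff ℝ n f → ContDiff ℝ n h →
      ContDiff ℝ n fun G : V →L[ℝ] V →L[ℝ] V => G (f G) (h G) := fun hf hh =>
    (contDiff_id.clm_apply hf).clm_apply hh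
  simp only [quadraticRicci_apply]
  exact (ContDiff.sum fun i _ => (hrepr i).comp
      (happ contDiff_const (happ contDiff_const contDiff_const))).sub
    (ContDiff.sum fun i _ => (hrepr i).comp
      (happ contDiff_const (happ contDiff_const contDiff_const)))

variable {N : Type*} (q : ι → ι → N) (d : N → ι)

/-- The symmetric Christoffel symbols with components `Γ_{jk}^i = p (q j k)` if `i = d (q j k)`, and
zero otherwise, where `q` is a labelling of the unordered pairs of indices. -/
noncomputable def offDiagonal : (N → ℝ) →L[ℝ] V →L[ℝ] V →L[ℝ] V :=
  ∑ j, ∑ k, (ContinuousLinearMap.proj (R := ℝ) (φ := fun _ : N => ℝ) (q j k)).smulRight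
    ((LinearMap.toContinuousLinearMap (b.coord j)).smulRight
      ((LinearMap.toContinuousLinearMap (b.coord k)).smulRight (b (d (q j k)))))

theorem offDiagonal_apply (p : N → ℝ) (v w : V) : offDiagonal b q d p v w =
    ∑ j, ∑ k, (p (q j k) * b.repr v j * b.repr w k) • b (d (q j k)) := by
  simp [offDiagonal, smul_smul, mul_assoc]

theorem offDiagonal_symm (hq : ∀ j k, q j k = q k j) (p : N → ℝ) (v w : V) :
    offDiagonal b q d p v w = offDiagonal b q d p w v := by
  rw [offDiagonal_apply, offDiagonal_apply, Finset.sum_comm]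
  refine Finset.sum_congr rfl fun j _ => Finset.sum_congr rfl fun k _ => ?_
  rw [hq, mul_right_comm]

theorem repr_offDiagonal [DecidableEq ι] (p : N → ℝ) (v w : V) (i : ι) :
    b.repr (offDiagonal b q d p v w) i =
      ∑ j, ∑ k, if d (q j k) = i then p (q j k) * b.repr v j * b.repr w k else 0 := by
  rw [offDiagonal_apply]
  simp only [map_sum, map_smul, Finsupp.coe_finsetSum, Finset.sum_apply, Finsupp.smul_apply,
    Module.Basis.repr_self, Finsupp.single_apply, smul_eq_mul, mul_ite, mul_one, mul_zero]

/-- No component has its upper index equal to its first lower index. This removes the derivative of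
the trace of `Γ` from the Ricci tensor. -/
theorem trace_offDiagonal (hd : ∀ j k, d (q j k) ≠ j) (p : N → ℝ) (w : V) :
    ∑ i, b.repr (offDiagonal b q d p (b i) w) i = 0 := by
  classical
  refine Finset.sum_eq_zero fun i _ => ?_
  rw [repr_offDiagonal]
  refine Finset.sum_eq_zero fun j _ => Finset.sum_eq_zero fun k _ => ?_
  split_ifs with h
  · have : j ≠ i := fun hj => hd j k (h.trans hj.symm)
    simp [this.symm]
  · rfl

/-- Each pair `j, k` occupies one slot, so each Ricci component sees one derivative of one unknown:
the system is already solved for its derivatives. -/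
theorem divergence_offDiagonal (φ : V →L[ℝ] N → ℝ) (v w : V) :
    ∑ i, b.repr (offDiagonal b q d (φ (b i)) v w) i =
      ∑ j, ∑ k, φ (b (d (q j k))) (q j k) * b.repr v j * b.repr w k := by
  classical
  simp only [repr_offDiagonal]
  rw [Finset.sum_comm]
  refine Finset.sum_congr rfl fun j _ => ?_
  rw [Finset.sum_comm]
  refine Finset.sum_congr rfl fun k _ => ?_
  rw [Finset.sum_ite_eq]
  simp

/-- The symmetric part of the Ricci tensor as a bilinear form. -/
noncomputable def ricciSymmForm {V : Type*} [AddCommGroup V] [Module ℝ V]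
    (A : V →ₗ[ℝ] V →ₗ[ℝ] Module.End ℝ V) : LinearMap.BilinForm ℝ V :=
  (2⁻¹ : ℝ) • (ricci A + LinearMap.flip (ricci A))

theorem ricciSymmForm_apply {V : Type*} [AddCommGroup V] [Module ℝ V]
    (A : V →ₗ[ℝ] V →ₗ[ℝ] Module.End ℝ V) (v w : V) : ricciSymmForm A v w = ricciSymm A v w := by
  simp [ricciSymmForm, ricciSymm]
  ring

open IsGeneralizedCurvatureOperator in
/-- The derivative that the components `p` of the off-diagonal part must have at `x` in order that
the symmetric Ricci tensor is `S x`. -/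
noncomputable def prescribed (A : V →ₗ[ℝ] V →ₗ[ℝ] Module.End ℝ V)
    (S : V → LinearMap.BilinForm ℝ V) (x : V) (p : N → ℝ) : LinearMap.BilinForm ℝ V :=
  S x - ricciSymmForm A - quadraticRicci b (linearChristoffel A x + offDiagonal b q d p)

open IsGeneralizedCurvatureOperator in
theorem prescribed_apply (A : V →ₗ[ℝ] V →ₗ[ℝ] Module.End ℝ V)
    (S : V → LinearMap.BilinForm ℝ V) (x : V) (p : N → ℝ) (v w : V) :
    prescribed b q d A S x p v w = S x v w - ricciSymmForm A v w -
      quadraticRicci b (linearChristoffel A x + offDiagonal b q d p) v w := rfl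

open IsGeneralizedCurvatureOperator in
theorem prescribed_symm (hq : ∀ j k, q j k = q k j) (A : V →ₗ[ℝ] V →ₗ[ℝ] Module.End ℝ V)
    {S : V → LinearMap.BilinForm ℝ V} (hS : ∀ x v w, S x v w = S x w v) (x : V) (p : N → ℝ)
    (v w : V) : prescribed b q d A S x p v w = prescribed b q d A S x p w v := by
  have hG : ∀ v w, (linearChristoffel A x + offDiagonal b q d p) v w =
      (linearChristoffel A x + offDiagonal b q d p) w v := fun v w =>
    congrArg₂ (· + ·) (linearChristoffel_symm A x v w) (offDiagonal_symm b q d hq p v w)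
  have hr : ricciSymmForm A v w = ricciSymmForm A w v := by
    rw [ricciSymmForm_apply, ricciSymmForm_apply, ricciSymm, ricciSymm, add_comm]
  rw [prescribed_apply, prescribed_apply, hS, hr, quadraticRicci_symm b hG]

variable [Fintype N]

open IsGeneralizedCurvatureOperator in
theorem contDiff_prescribed {n : ℕ∞ω} (A : V →ₗ[ℝ] V →ₗ[ℝ] Module.End ℝ V)
    {S : V → LinearMap.BilinForm ℝ V} (hS : ∀ v w, ContDiff ℝ n fun x => S x v w) (v w : V) :
    ContDiff ℝ n fun z : V × (N → ℝ) => prescribed b q d A S z.1 z.2 v w := by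
  simp only [prescribed_apply]
  have h1 : ContDiff ℝ n fun z : V × (N → ℝ) => S z.1 v w :=
    (hS v w).comp (contDiff_fst (E := V) (F := N → ℝ))
  have h2 : ContDiff ℝ n fun z : V × (N → ℝ) =>
      linearChristoffel A z.1 + offDiagonal b q d z.2 := by fun_prop
  exact (h1.sub contDiff_const).sub ((contDiff_quadraticRicci b v w).comp h2)

theorem contDiff_prescribed_components {n : ℕ∞ω} (A : V →ₗ[ℝ] V →ₗ[ℝ] Module.End ℝ V)
    {S : V → LinearMap.BilinForm ℝ V} (hS : ∀ v w, ContDiff ℝ n fun x => S x v w)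
    (r : N → ι × ι) (e : V ≃L[ℝ] (ι → ℝ)) :
    ContDiff ℝ n fun (z : (ι → ℝ) × (N → ℝ)) (s : N) =>
      prescribed b q d A S (e.symm z.1) z.2 (b (r s).1) (b (r s).2) := by
  have h : ContDiff ℝ n fun z : (ι → ℝ) × (N → ℝ) => (e.symm z.1, z.2) := by
    fun_prop
  exact contDiff_pi.2 fun s =>
    (contDiff_prescribed b q d A hS (b (r s).1) (b (r s).2)).comp
      (f := fun z : (ι → ℝ) × (N → ℝ) => (e.symm z.1, z.2)) h

/-- Components of an off-diagonal symmetric tensor solving the Ricci equation near `0`. -/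
theorem exists_components {ι N : Type} [Fintype ι] [Fintype N] (b : Module.Basis ι ℝ V)
    (q : ι → ι → N) (d : N → ι) (hq : ∀ j k, q j k = q k j) (r : N → ι × ι)
    (hr : ∀ j k, r (q j k) = (j, k) ∨ r (q j k) = (k, j)) {n : ℕ∞ω}
    (hn1 : 1 ≤ n) (hn : (∃ s : ℕ, n = s) ∨ n = ω)
    (A : V →ₗ[ℝ] V →ₗ[ℝ] Module.End ℝ V) {S : V → LinearMap.BilinForm ℝ V}
    (hS : ∀ v w, ContDiff ℝ n fun x => S x v w) (hsymm : ∀ x v w, S x v w = S x w v)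
    (h0 : S 0 = ricciSymmForm A) :
    ∃ (U : TopologicalSpace.Opens V) (f : V → N → ℝ), (0 : V) ∈ U ∧
      ContDiffOn ℝ n f U ∧ f 0 = 0 ∧ fderiv ℝ f 0 = 0 ∧ ∀ x ∈ U, ∀ j k,
        fderiv ℝ f x (b (d (q j k))) (q j k) = prescribed b q d A S x (f x) (b j) (b k) := by
  classical
  let e : V ≃L[ℝ] (ι → ℝ) := b.equivFunL
  let F : (ι → ℝ) × (N → ℝ) → N → ℝ := fun z s =>
    prescribed b q d A S (e.symm z.1) z.2 (b (r s).1) (b (r s).2)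
  have hF : ContDiff ℝ n F := contDiff_prescribed_components b q d A hS r e
  obtain ⟨f, δ, hδ, hf, hf0, hfd⟩ := Goursat.exists_solution hn1 hn d F hF
  have hn0 : n ≠ 0 := (zero_lt_one.trans_le hn1).ne'
  have heb : ∀ i, e (b i) = Pi.single i 1 := by
    intro i
    ext j
    simp [e, Module.Basis.equivFunL, Pi.single_apply, eq_comm]
  have hder : ∀ x, e x ∈ Metric.ball 0 δ →
      fderiv ℝ (fun x => f (e x)) x = (fderiv ℝ f (e x)).comp (e : V →L[ℝ] (ι → ℝ)) := by
    intro x hx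
    exact (((hf _ hx).differentiableAt hn0).hasFDerivAt.comp x e.hasFDerivAt).fderiv
  -- `F` uses the representative of each pair chosen by `r`; symmetry of the prescribed form makes
  -- the choice immaterial.
  have hout : ∀ x p j k, prescribed b q d A S x p (b (r (q j k)).1) (b (r (q j k)).2) =
      prescribed b q d A S x p (b j) (b k) := by
    intro x p j k
    rcases hr j k with h | h
    · rw [h]
    · rw [h, prescribed_symm b q d hq A hsymm]
  have hmem0 : (0 : ι → ℝ) ∈ Metric.ball 0 δ := Metric.mem_ball_self hδ
  have hf00 : f 0 = 0 := funext fun s => hf0 0 hmem0 s rfl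
  have hfd0 : fderiv ℝ f 0 = 0 := by
    have hcomp : ∀ i s, fderiv ℝ f 0 (Pi.single i 1) s = 0 := by
      intro i s
      -- In the direction `d s` the equation applies, and its right side is zero at the origin by
      -- `h0`. Any other axis lies in the hyperplane `x (d s) = 0`, on which `f · s` vanishes.
      by_cases h : i = d s
      · subst h
        rw [hfd 0 hmem0 s]
        simp [F, hf00, prescribed, h0, quadraticRicci_zero]
      · have h1 := ((hf 0 hmem0).differentiableAt hn0).hasFDerivAt
        have h2 : HasDerivAt (fun a : ℝ => a • (Pi.single i 1 : ι → ℝ)) (Pi.single i 1) 0 := by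
          simpa using (hasDerivAt_id (0 : ℝ)).smul_const (Pi.single i 1 : ι → ℝ)
        have h3 := h1.comp_hasDerivAt_of_eq (0 : ℝ) h2 (by simp)
        have h4 := hasDerivAt_pi.1 h3 s
        have h5 : HasDerivAt (fun a : ℝ => f (a • (Pi.single i 1 : ι → ℝ)) s) 0 0 := by
          refine (hasDerivAt_const (0 : ℝ) (0 : ℝ)).congr_of_eventuallyEq ?_
          have hev : ∀ᶠ a : ℝ in nhds 0, a • (Pi.single i 1 : ι → ℝ) ∈ Metric.ball 0 δ :=
            h2.continuousAt (by simpa using Metric.ball_mem_nhds (0 : ι → ℝ) hδ)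
          filter_upwards [hev] with a ha
          exact hf0 _ ha s (by simp [Ne.symm h])
        exact h4.unique h5
    refine ContinuousLinearMap.coe_injective ((Pi.basisFun ℝ (ι)).ext fun i => ?_)
    ext s
    simpa using hcomp i s
  refine ⟨⟨e ⁻¹' Metric.ball 0 δ, Metric.isOpen_ball.preimage e.continuous⟩, fun x => f (e x),
    by simpa using hδ, fun x hx => ?_, by simpa using hf00, ?_, fun x hx j k => ?_⟩
  · exact ((hf _ hx).comp x e.contDiff.contDiffAt).contDiffWithinAt
  · rw [hder 0 (by simpa using hδ), map_zero, hfd0, ContinuousLinearMap.zero_comp]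
  · rw [hder x hx, ContinuousLinearMap.comp_apply, ContinuousLinearEquiv.coe_coe, heb,
      hfd _ hx (q j k)]
    simp only [F, e.symm_apply_apply]
    exact hout x _ j k

end ChristoffelAnsatz

/-! ### Curvature of the corrected Christoffel symbols -/

theorem fderiv_clm_add_clm_comp {X P E : Type*} [NormedAddCommGroup X] [NormedSpace ℝ X]
    [NormedAddCommGroup P] [NormedSpace ℝ P] [NormedAddCommGroup E] [NormedSpace ℝ E]
    (L : X →L[ℝ] E) (T : P →L[ℝ] E) {f : X → P} {x : X} (hf : DifferentiableAt ℝ f x) :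
    fderiv ℝ (fun y => L y + T (f y)) x = L + T.comp (fderiv ℝ f x) :=
  (L.hasFDerivAt.fun_add (T.hasFDerivAt.comp x hf.hasFDerivAt)).fderiv

theorem fderiv_christoffel_family {V P : Type*} [NormedAddCommGroup V] [NormedSpace ℝ V]
    [NormedAddCommGroup P] [NormedSpace ℝ P] (L : V →L[ℝ] V →L[ℝ] V →L[ℝ] V)
    (T : P →L[ℝ] V →L[ℝ] V →L[ℝ] V) {f : V → P} {x : V} (hf : DifferentiableAt ℝ f x) (u v w : V) :
    fderiv ℝ (fun y => L y + T (f y)) x u v w = L u v w + T (fderiv ℝ f x u) v w := by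
  have h := fderiv_clm_add_clm_comp (E := V →L[ℝ] V →L[ℝ] V) L T hf
  exact congrArg (fun D : V →L[ℝ] V →L[ℝ] V →L[ℝ] V => D u v w) h

namespace ChristoffelAnsatz

open IsGeneralizedCurvatureOperator

variable {V ι N : Type*} [NormedAddCommGroup V] [NormedSpace ℝ V] [FiniteDimensional ℝ V]
  [Fintype ι] (b : Module.Basis ι ℝ V) (q : ι → ι → N) (d : N → ι)

/-- Linear Christoffel symbols realizing `A` at the origin, corrected by an off-diagonal term with
components `f`. -/
noncomputable def christoffel (A : V →ₗ[ℝ] V →ₗ[ℝ] Module.End ℝ V) (f : V → N → ℝ) (x : V) :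
    V →L[ℝ] V →L[ℝ] V :=
  linearChristoffel A x + offDiagonal b q d (f x)

theorem christoffel_symm (hq : ∀ j k, q j k = q k j) (A : V →ₗ[ℝ] V →ₗ[ℝ] Module.End ℝ V)
    (f : V → N → ℝ) (x v w : V) :
    christoffel b q d A f x v w = christoffel b q d A f x w v :=
  congrArg₂ (· + ·) (linearChristoffel_symm A x v w) (offDiagonal_symm b q d hq (f x) v w)

variable [Fintype N]

theorem contDiffOn_christoffel {n : ℕ∞ω} (A : V →ₗ[ℝ] V →ₗ[ℝ] Module.End ℝ V) {f : V → N → ℝ}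
    {s : Set V} (hf : ContDiffOn ℝ n f s) : ContDiffOn ℝ n (christoffel b q d A f) s := by
  have h : ContDiffOn ℝ n (fun x => linearChristoffel A x + offDiagonal b q d (f x)) s := by
    fun_prop
  exact h

theorem fderiv_christoffel (A : V →ₗ[ℝ] V →ₗ[ℝ] Module.End ℝ V) {f : V → N → ℝ} {x : V}
    (hf : DifferentiableAt ℝ f x) (u v w : V) :
    fderiv ℝ (christoffel b q d A f) x u v w =
      linearChristoffel A u v w + offDiagonal b q d (fderiv ℝ f x u) v w :=
  fderiv_christoffel_family (linearChristoffel A) (offDiagonal b q d) hf u v w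

/-- Contracting the curvature gives `ρ(A)` from the linear part, the divergence of the correction,
no trace term, and the quadratic part. The equation for `f` makes the divergence `S - ρ_s(A)` minus
the quadratic part, so only `S + ρ_a(A)` survives. -/
theorem ricci_curvature_christoffel {n : ℕ∞ω} (hn : 1 ≤ n) {U : TopologicalSpace.Opens V}
    {A : V →ₗ[ℝ] V →ₗ[ℝ] Module.End ℝ V} (hA : IsGeneralizedCurvatureOperator A)
    (hd : ∀ j k, d (q j k) ≠ j) {S : V → LinearMap.BilinForm ℝ V} {f : V → N → ℝ}
    (hf : ContDiffOn ℝ n f U) (x : U)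
    (h : ∀ j k, fderiv ℝ f x (b (d (q j k))) (q j k) = prescribed b q d A S x (f x) (b j) (b k))
    (v w : V) :
    ricci ((AffineConnection.ofChristoffel (christoffel b q d A f)
      (contDiffOn_christoffel b q d A hf)).curvature hn x) v w =
      S x v w + ricciAntisymm A v w := by
  have hdiff : DifferentiableAt ℝ f x := (hf.contDiffAt (U.isOpen.mem_nhds x.2)).differentiableAt
    (zero_lt_one.trans_le hn).ne'
  set G := christoffel b q d A f x with hG
  have hterm : ∀ i, (AffineConnection.ofChristoffel (christoffel b q d A f)
      (contDiffOn_christoffel b q d A hf)).curvature hn x (b i) v w =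
      A (b i) v w + offDiagonal b q d (fderiv ℝ f x (b i)) v w -
        offDiagonal b q d (fderiv ℝ f x v) (b i) w + (G (b i) (G v w) - G v (G (b i) w)) := by
    intro i
    rw [AffineConnection.curvature_ofChristoffel, fderiv_christoffel b q d A hdiff,
      fderiv_christoffel b q d A hdiff, ← linearChristoffel_sub hA]
    abel
  rw [ricci_eq_sum b]
  simp only [hterm, map_add, map_sub, Finsupp.add_apply, Finsupp.sub_apply,
    Finset.sum_add_distrib, Finset.sum_sub_distrib]
  rw [← ricci_eq_sum b, trace_offDiagonal b q d hd,
    divergence_offDiagonal b q d (fderiv ℝ f x) v w]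
  simp only [h]
  rw [← bilinForm_eq_sum, prescribed_apply, ← quadraticRicci_apply, ricci_eq_symm_add_antisymm,
    ricciSymmForm_apply, hG, christoffel]
  ring

/-- At the origin `Γ` vanishes, which removes the quadratic terms, and so does the derivative of the
correction; `linearChristoffel_sub` does the rest. -/
theorem curvature_christoffel_zero {n : ℕ∞ω} (hn : 1 ≤ n) {U : TopologicalSpace.Opens V}
    (hU : (0 : V) ∈ U) {A : V →ₗ[ℝ] V →ₗ[ℝ] Module.End ℝ V} (hA : IsGeneralizedCurvatureOperator A)
    {f : V → N → ℝ} (hf : ContDiffOn ℝ n f U) (hf0 : f 0 = 0) (hf' : fderiv ℝ f 0 = 0) :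
    (AffineConnection.ofChristoffel (christoffel b q d A f)
      (contDiffOn_christoffel b q d A hf)).curvature hn ⟨0, hU⟩ = A := by
  have hdiff : DifferentiableAt ℝ f 0 := (hf.contDiffAt (U.isOpen.mem_nhds hU)).differentiableAt
    (zero_lt_one.trans_le hn).ne'
  have h0 : christoffel b q d A f 0 = 0 := by
    rw [christoffel, hf0, map_zero, map_zero, add_zero]
  ext u v w
  rw [AffineConnection.curvature_ofChristoffel]
  simp only
  rw [fderiv_christoffel b q d A hdiff, fderiv_christoffel b q d A hdiff, h0, hf',
    ← linearChristoffel_sub hA]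
  simp

end ChristoffelAnsatz

/-! ### Assembling the connection and the five claims -/

theorem exists_notMem_sym2 {m : ℕ} (hm : 3 ≤ m) (s : Sym2 (Fin m)) : ∃ i, i ∉ s := by
  induction s with
  | _ j k =>
    have h : ({j, k} : Finset (Fin m)).card < (Finset.univ : Finset (Fin m)).card := by
      rw [Finset.card_fin]
      exact (Finset.card_le_two).trans_lt hm
    obtain ⟨i, -, hi⟩ := Finset.exists_mem_notMem_of_card_lt_card h
    exact ⟨i, by simpa using hi⟩

/-- A generalized algebraic curvature operator `A` is realized at the origin by a torsion-free
connection whose symmetric Ricci tensor is a prescribed extension of that of `A`, and whose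
antisymmetric Ricci tensor is constant. -/
theorem exists_connection_ricci_eq {V : Type*} [NormedAddCommGroup V] [NormedSpace ℝ V]
    [FiniteDimensional ℝ V] (hm : 3 ≤ Module.finrank ℝ V)
    {n : ℕ∞ω} (hn : 1 ≤ n) (hn_fin : (∃ s : ℕ, n = s) ∨ n = ω)
    {A : V →ₗ[ℝ] V →ₗ[ℝ] Module.End ℝ V} (hA : IsGeneralizedCurvatureOperator A)
    {S : V → LinearMap.BilinForm ℝ V} (hS : ∀ v w, ContDiff ℝ n fun x => S x v w)
    (hsymm : ∀ x v w, S x v w = S x w v) (h0 : S 0 = ChristoffelAnsatz.ricciSymmForm A) :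
    ∃ (U : TopologicalSpace.Opens V) (h0 : (0 : V) ∈ U) (D : AffineConnection U n),
      D.IsTorsionFree ∧ D.curvature hn ⟨0, h0⟩ = A ∧
      ∀ x v w, ricci (D.curvature hn x) v w = S x v w + ricciAntisymm A v w := by
  let b := Module.finBasis ℝ V
  choose d hd using exists_notMem_sym2 hm
  have hq : ∀ j k : Fin (Module.finrank ℝ V), s(j, k) = s(k, j) := fun j k => Sym2.eq_swap
  have hr : ∀ j k : Fin (Module.finrank ℝ V),
      Quot.out s(j, k) = (j, k) ∨ Quot.out s(j, k) = (k, j) := by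
    intro j k
    have h : s((Quot.out s(j, k)).1, (Quot.out s(j, k)).2) = s(j, k) := Quot.out_eq _
    exact (Sym2.eq_iff.1 h).imp (fun h => Prod.ext h.1 h.2) fun h => Prod.ext h.1 h.2
  obtain ⟨U, f, hU, hf, hf0, hf', h⟩ := ChristoffelAnsatz.exists_components b
    (fun j k => s(j, k)) d hq Quot.out hr hn hn_fin A hS hsymm h0
  refine ⟨U, hU, AffineConnection.ofChristoffel _
    (ChristoffelAnsatz.contDiffOn_christoffel b (fun j k => s(j, k)) d A hf), ?_, ?_, ?_⟩
  · exact AffineConnection.isTorsionFree_ofChristoffel _ _ fun x _ v w =>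
      ChristoffelAnsatz.christoffel_symm b _ d hq A f x v w
  · exact ChristoffelAnsatz.curvature_christoffel_zero b _ d hn hU hA hf hf0 hf'
  · intro x v w
    refine ChristoffelAnsatz.ricci_curvature_christoffel b _ d hn hA (fun j k hjk => ?_) hf x
      (h x x.2) v w
    exact hd s(j, k) (by rw [hjk]; exact Sym2.mem_mk_left j k)

theorem theorem1p3 {V : Type*} [NormedAddCommGroup V] [NormedSpace ℝ V] [FiniteDimensional ℝ V]
    (hm : 3 ≤ Module.finrank ℝ V)
    (n : ℕ∞ω) (hn : 1 ≤ n) (hn_fin : (∃ s : ℕ, n = s) ∨ n = ω)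
    (g : PseudoRiemannianMetric V n)
    (A : V →ₗ[ℝ] V →ₗ[ℝ] Module.End ℝ V) (hA : IsGeneralizedCurvatureOperator A) :
    ∃ (U : TopologicalSpace.Opens V) (h0 : (0 : V) ∈ U) (D : AffineConnection U n),
      D.IsTorsionFree ∧
      D.curvature hn ⟨0, h0⟩ = A ∧
      (∃ c : ℝ, ∀ x : U, scalarCurvature (D.curvature hn x) (g.form x) = c) ∧
      (IsRicciSymmetric A → ∀ x : U, IsRicciSymmetric (D.curvature hn x)) ∧
      (IsRicciAntisymmetric A → ∀ x : U, IsRicciAntisymmetric (D.curvature hn x)) ∧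
      (IsRicciTraceFreeVanishing A (g.form 0) →
        ∀ x : U, IsRicciTraceFreeVanishing (D.curvature hn x) (g.form x)) ∧
      (IsRicciTraceZero A (g.form 0) →
        ∀ x : U, IsRicciTraceZero (D.curvature hn x) (g.form x)) := by
  have : Nontrivial V := Module.nontrivial_of_finrank_pos (R := ℝ) (by omega)
  have hsymm : ∀ x v w, g.extend (ChristoffelAnsatz.ricciSymmForm A) x v w =
      g.extend (ChristoffelAnsatz.ricciSymmForm A) x w v := g.extend_symm fun v w => by
    rw [ChristoffelAnsatz.ricciSymmForm_apply, ChristoffelAnsatz.ricciSymmForm_apply, ricciSymm,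
      ricciSymm, add_comm]
  obtain ⟨U, h0, D, hD, hD0, hric⟩ := exists_connection_ricci_eq hm hn hn_fin hA
    (g.contDiff_extend (ChristoffelAnsatz.ricciSymmForm A)) hsymm (g.extend_zero _)
  have hRs : ∀ x v w, ricciSymm (D.curvature hn x) v w =
      g.extend (ChristoffelAnsatz.ricciSymmForm A) x v w := by
    intro x v w
    rw [ricciSymm, hric, hric, hsymm x w v, ricciAntisymm, ricciAntisymm]
    ring
  have hRa : ∀ x v w, ricciAntisymm (D.curvature hn x) v w = ricciAntisymm A v w := by
    intro x v w
    rw [ricciAntisymm, hric, hric, hsymm x w v, ricciAntisymm, ricciAntisymm]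
    ring
  -- As `g_x` is symmetric, its trace ignores the antisymmetric part of the Ricci tensor.
  have hτs : ∀ (B : V →ₗ[ℝ] V →ₗ[ℝ] Module.End ℝ V) (x : V),
      scalarCurvature B (g.form x) = metricTrace (g.form x) (ricciSymm B) := by
    intro B x
    have h : ricciSymm B = fun v w => 2⁻¹ * (ricci B v w + ricci B w v) := by
      ext v w
      rw [ricciSymm]
      ring
    rw [scalarCurvature_eq_metricTrace, h, metricTrace_mul, metricTrace_add,
      metricTrace_swap (g.form_symm x) (fun v w => ricci B v w)]
    ring
  have hτA : metricTrace (g.form 0) (fun v w => ChristoffelAnsatz.ricciSymmForm A v w) =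
      scalarCurvature A (g.form 0) := by
    rw [hτs]
    simp only [ChristoffelAnsatz.ricciSymmForm_apply]
  have hτ : ∀ x : U, scalarCurvature (D.curvature hn x) (g.form x) =
      scalarCurvature A (g.form 0) := by
    intro x
    rw [hτs, funext fun v => funext fun w => hRs x v w, g.metricTrace_extend, hτA]
  have hfree : IsRicciTraceFreeVanishing A (g.form 0) → ∀ x v w,
      g.extend (ChristoffelAnsatz.ricciSymmForm A) x v w =
        scalarCurvature A (g.form 0) / Module.finrank ℝ V * g.form x v w := by
    intro h x v w
    rw [← hτA]
    refine g.extend_eq_of_traceFree (fun v w => ?_) x v w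
    rw [ChristoffelAnsatz.ricciSymmForm_apply, hτA]
    exact sub_eq_zero.1 (h v w)
  refine ⟨U, h0, D, hD, hD0, ⟨_, hτ⟩, fun h x v w => (hRa x v w).trans (h v w),
    fun h x v w => ?_, fun h x v w => ?_, fun h x => (hτ x).trans h⟩
  -- The case `ρ_s(A) = 0` reduces to the trace-free one: `τ` vanishes too, so the prescribed
  -- multiple of `g_x` is zero.
  · have hc : scalarCurvature A (g.form 0) = 0 := by
      rw [hτs, funext fun v => funext fun w => h v w]
      simp [metricTrace]
    rw [hRs, hfree (fun v w => by rw [ricciTraceFree, h v w, hc]; simp), hc]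
    simp
  · rw [ricciTraceFree, hRs, hτ, hfree h, sub_self]
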